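/- **Theorem.** Let $k$ be an algebraically closed field of characteristic $0$, let $X\subset\mathbb A^n_k$ be an irreducible affine variety of dimension $s$ with coordinate ring $A=k[x_1,\dots,x_n]/I_X$, and let $\mathcal V=\mathrm{Der}_k(A)$ be the Lie algebra of polynomial vector fields on $X$. Let $p\in X$ be a non-singular point (i.e. the local ring of $X$ at $p$ is regular), let $\mathfrak m_p\subset A$ be the maximal ideal of functions vanishing at $p$, and for $l\ge 0$ put $\mathcal V(l)=\{\eta\in\mathcal V : \eta(A)\subset\mathfrak m_p^{\,l+1}\}$. Write $\mathcal V_+=\mathcal V(0)$; each $\mathcal V(l)$ is an ideal of the Lie algebra $\mathcal V_+$. For a Lie algebra $\mathcal L$ acting on $A$ by derivations, let $A\#U(\mathcal L)$ denote the smash product of $A$ with the universal enveloping algebra $U(\mathcal L)$, i.e. the space $A\otimes_k U(\mathcal L)$ with the product $(f\# u)(g\# v)=\sum f\,u_{(1)}(g)\,\#\,u_{(2)}v$; in it $\eta f-f\eta=\eta(f)$ for $\eta\in\mathcal L$, $f\in A$. An $A\mathcal V$-module is a left module over $A\#U(\mathcal V)$. A module $U$ over the Lie algebra $\mathcal V_+/\mathcal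 V(1)$ becomes an $A\#U(\mathcal V_+)$-module on which $\mathcal V_+$ acts through its quotient and $f\in A$ acts by the scalar $f(p)$; the Rudakov module is the induced module $$R_p(U)=A\#U(\mathcal V)\otimes_{A\#U(\mathcal V_+)}U .$$ Then there is an isomorphism of Lie algebras $\mathcal V_+/\mathcal V(1)\cong\mathfrak{gl}_s(k)$, and for every finite-dimensional simple $\mathcal V_+/\mathcal V(1)$-module $U$ the Rudakov module $R_p(U)$ is a simple $A\mathcal V$-module. -/

import Mathlib

open scoped TensorProduct

-- The commutator bracket on an associative algebra.
attribute [local instance 100] LieRing.ofAssociativeRing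

noncomputable section

/-! ## Irreducible affine varieties -/

section Variety

variable {k : Type*} [Field k] {n : ℕ}

/-- A subset of affine `n`-space is Zariski closed if it is the zero locus of an ideal. -/
def IsZariskiClosed (X : Set (Fin n → k)) : Prop :=
  ∃ I : Ideal (MvPolynomial (Fin n) k), X = MvPolynomial.zeroLocus k I

/-- An irreducible affine variety in affine `n`-space: a non-empty Zariski closed subset that is
not covered by two Zariski closed sets unless one of them already contains it. -/
structure IsIrreducibleAffineVariety (X : Set (Fin n → k)) : Prop where
  isClosed : IsZariskiClosed X
  nonempty : X.Nonempty
  irreducible : ∀ Y Z : Set (Fin n → k), IsZariskiClosed Y → IsZariskiClosed Z →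
    X ⊆ Y ∪ Z → X ⊆ Y ∨ X ⊆ Z

/-- The algebra `A_X = k[x₁, …, xₙ] / I_X` of polynomial functions on `X`. -/
abbrev CoordinateRing (X : Set (Fin n → k)) : Type _ :=
  MvPolynomial (Fin n) k ⧸ MvPolynomial.vanishingIdeal k X

/-- Evaluation `f ↦ f(p)` of polynomial functions at a point `p` of `X`. -/
def evalPoint (X : Set (Fin n → k)) (p : X) : CoordinateRing X →ₐ[k] k :=
  Ideal.Quotient.liftₐ (MvPolynomial.vanishingIdeal k X) (MvPolynomial.aeval (p : Fin n → k))
    fun _ hf => MvPolynomial.mem_vanishingIdeal_iff.1 hf p p.2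

end Variety

/-! ## Points of an algebra -/

section Point

variable {k A : Type*} [Field k] [CommRing A] [Algebra k A]

/-- The maximal ideal `𝔪_p` of functions vanishing at the point `p`, where `p` is given by its
evaluation homomorphism `ε : A → k`. -/
def pointIdeal (ε : A →ₐ[k] k) : Ideal A := RingHom.ker ε

instance pointIdeal.instIsPrime (ε : A →ₐ[k] k) : (pointIdeal ε).IsPrime :=
  RingHom.ker_isPrime (ε : A →+* k)

/-- A point is non-singular if its local ring is a regular local ring. -/
def IsNonsingularPoint (ε : A →ₐ[k] k) : Prop :=
  IsRegularLocalRing (Localization.AtPrime (pointIdeal ε))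

/-- The Lie subalgebra `𝒱(l) = {η ∈ Der A | η(A) ⊆ 𝔪_p ^ (l + 1)}` for `l ≥ 0`. -/
def vanishingFields (ε : A →ₐ[k] k) (l : ℕ) : LieSubalgebra k (Derivation k A A) where
  carrier := {η | ∀ f : A, η f ∈ pointIdeal ε ^ (l + 1)}
  zero_mem' := fun _ => Ideal.zero_mem _
  add_mem' := fun ha hb f => Ideal.add_mem _ (ha f) (hb f)
  smul_mem' := fun c η hη f => Submodule.smul_of_tower_mem _ c (hη f)
  lie_mem' := fun {η ξ} hη hξ f => by
    rw [Derivation.commutator_apply]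
    exact Ideal.sub_mem _ (hη _) (hξ _)

theorem vanishingFields_zero_apply_mem {ε : A →ₐ[k] k} {ξ : Derivation k A A}
    (hξ : ξ ∈ vanishingFields ε 0) (f : A) : ξ f ∈ pointIdeal ε := by
  simpa using hξ f

theorem vanishingFields_zero_apply_pow_mem {ε : A →ₐ[k] k} {ξ : Derivation k A A}
    (hξ : ξ ∈ vanishingFields ε 0) (j : ℕ) {f : A} (hf : f ∈ pointIdeal ε ^ j) :
    ξ f ∈ pointIdeal ε ^ j := by
  induction j generalizing f with
  | zero => simp
  | succ j ih =>
    rw [pow_succ] at hf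
    induction hf using Submodule.mul_induction_on' with
    | mem_mul_mem a ha b hb =>
      rw [Derivation.leibniz, smul_eq_mul, smul_eq_mul, pow_succ, mul_comm b]
      exact Ideal.add_mem _ (Ideal.mul_mem_mul ha (vanishingFields_zero_apply_mem hξ b))
        (Ideal.mul_mem_mul (ih ha) hb)
    | add a _ b _ ha hb => rw [map_add]; exact Ideal.add_mem _ ha hb

/-- `𝒱(l)` for `l ≥ 0`, as an ideal of the Lie algebra `𝒱₊ = 𝒱(0)`. -/
def vanishingIdealOfFields (ε : A →ₐ[k] k) (l : ℕ) : LieIdeal k (vanishingFields ε 0) where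
  carrier := {η | (η : Derivation k A A) ∈ vanishingFields ε l}
  zero_mem' := (vanishingFields ε l).zero_mem
  add_mem' := fun ha hb => (vanishingFields ε l).add_mem ha hb
  smul_mem' := fun c _ hη => (vanishingFields ε l).smul_mem c hη
  lie_mem := fun {ξ η} hη f => by
    rw [LieSubalgebra.coe_bracket, Derivation.commutator_apply]
    exact Ideal.sub_mem _ (vanishingFields_zero_apply_pow_mem ξ.2 _ (hη f)) (hη _)

/-- The Lie algebra `𝒱₊ / 𝒱(1)`. -/
abbrev LinearFields (ε : A →ₐ[k] k) : Type _ :=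
  vanishingFields ε 0 ⧸ vanishingIdealOfFields ε 1

/-- The quotient map `𝒱₊ → 𝒱₊ / 𝒱(1)`. -/
def linearFieldsMk (ε : A →ₐ[k] k) : vanishingFields ε 0 →ₗ⁅k⁆ LinearFields ε where
  toLinearMap := (vanishingIdealOfFields ε 1).toSubmodule.mkQ
  map_lie' := rfl

end Point

/-! ## The smash product `A # U(L)` -/

section Smash

variable {k A L : Type*} [CommRing k] [CommRing A] [Algebra k A] [LieRing L] [LieAlgebra k L]

/-- The smash product `A # U(L)` for a Lie algebra `L` acting on the commutative algebra `A` by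
derivations through `ρ`: the `k`-module `A ⊗ U(L)` with the product
`(f # u) (g # v) = ∑ f u₍₁₎(g) # u₍₂₎ v`. -/
@[nolint unusedArguments]
def SmashProduct (_ρ : L →ₗ⁅k⁆ Derivation k A A) : Type _ :=
  A ⊗[k] UniversalEnvelopingAlgebra k L

namespace SmashProduct

variable (ρ : L →ₗ⁅k⁆ Derivation k A A)

instance : AddCommGroup (SmashProduct ρ) :=
  inferInstanceAs (AddCommGroup (A ⊗[k] UniversalEnvelopingAlgebra k L))

instance : Module A (SmashProduct ρ) :=
  inferInstanceAs (Module A (A ⊗[k] UniversalEnvelopingAlgebra k L))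

instance : Module k (SmashProduct ρ) :=
  inferInstanceAs (Module k (A ⊗[k] UniversalEnvelopingAlgebra k L))

instance : IsScalarTower k A (SmashProduct ρ) :=
  inferInstanceAs (IsScalarTower k A (A ⊗[k] UniversalEnvelopingAlgebra k L))

/-- The element `f # u`. -/
def tmul (f : A) (u : UniversalEnvelopingAlgebra k L) : SmashProduct ρ := f ⊗ₜ[k] u

/-- `x ∈ L` acts on `A ⊗ U(L)` by `g # v ↦ x(g) # v + g # x v`. -/
def lieActTensor : L →ₗ⁅k⁆ Module.End k (A ⊗[k] UniversalEnvelopingAlgebra k L) where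
  toFun x := LinearMap.rTensor (UniversalEnvelopingAlgebra k L) (ρ x : A →ₗ[k] A) +
    LinearMap.lTensor A (LinearMap.mulLeft k (UniversalEnvelopingAlgebra.ι k x))
  map_add' x y := by
    refine TensorProduct.ext' fun g v => ?_
    simp only [LinearMap.add_apply, LinearMap.rTensor_tmul, LinearMap.lTensor_tmul, map_add,
      LinearMap.mulLeft_apply, TensorProduct.add_tmul, TensorProduct.tmul_add, add_mul,
      Derivation.coeFn_coe, Derivation.add_apply]
    abel
  map_smul' c x := by
    refine TensorProduct.ext' fun g v => ?_
    simp only [LinearMap.add_apply, LinearMap.rTensor_tmul, LinearMap.lTensor_tmul, map_smul,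
      LinearMap.mulLeft_apply, LinearMap.smul_apply, RingHom.id_apply, smul_add,
      Derivation.coeFn_coe, Derivation.smul_apply, smul_mul_assoc, TensorProduct.tmul_smul,
      TensorProduct.smul_tmul']
  map_lie' {x y} := by
    refine TensorProduct.ext' fun g v => ?_
    simp only [LieRing.of_associative_ring_bracket, LinearMap.add_apply, LinearMap.rTensor_tmul,
      LinearMap.lTensor_tmul, LinearMap.mulLeft_apply, LinearMap.sub_apply, LieHom.map_lie,
      Derivation.coeFn_coe, Derivation.commutator_apply, Module.End.mul_apply, map_add,
      TensorProduct.sub_tmul, TensorProduct.tmul_sub, sub_mul, mul_assoc]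
    abel

/-- The action of `L` on the smash product by left multiplication. -/
def lieAct : L →ₗ⁅k⁆ Module.End k (SmashProduct ρ) := lieActTensor ρ

/-- The action of `U(L)` on `A ⊗ U(L)` extending that of `L`: since the elements of `L` are
primitive, `u` acts by `g # v ↦ ∑ u₍₁₎(g) # u₍₂₎ v`. -/
def act : UniversalEnvelopingAlgebra k L →ₐ[k] Module.End k (SmashProduct ρ) :=
  UniversalEnvelopingAlgebra.lift k (lieAct ρ)

/-- Left multiplication in the smash product: `f # u` sends `y` to `f • (u · y)`. -/
def mulHom : SmashProduct ρ →ₗ[k] Module.End k (SmashProduct ρ) :=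
  TensorProduct.lift (LinearMap.mk₂ k
    (fun (f : A) (u : UniversalEnvelopingAlgebra k L) =>
      (Algebra.lsmul k k (SmashProduct ρ) f : Module.End k (SmashProduct ρ)) * act ρ u)
    (fun f g u => by rw [map_add, add_mul]) (fun c f u => by rw [map_smul, smul_mul_assoc])
    (fun f u v => by rw [map_add, mul_add]) (fun c f u => by rw [map_smul, mul_smul_comm]))

instance : Mul (SmashProduct ρ) := ⟨fun x y => mulHom ρ x y⟩

instance : One (SmashProduct ρ) := ⟨tmul ρ 1 1⟩

variable {ρ}

theorem induction_on {P : SmashProduct ρ → Prop} (x : SmashProduct ρ) (h0 : P 0)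
    (ht : ∀ f u, P (tmul ρ f u)) (ha : ∀ x y, P x → P y → P (x + y)) : P x :=
  TensorProduct.induction_on x h0 ht ha

theorem mul_def (x y : SmashProduct ρ) : x * y = mulHom ρ x y := rfl

theorem tmul_mul (f : A) (u : UniversalEnvelopingAlgebra k L) (y : SmashProduct ρ) :
    tmul ρ f u * y = f • act ρ u y := rfl

theorem act_ι_tmul (x : L) (g : A) (v : UniversalEnvelopingAlgebra k L) :
    act ρ (UniversalEnvelopingAlgebra.ι k x) (tmul ρ g v) =
      tmul ρ (ρ x g) v + tmul ρ g (UniversalEnvelopingAlgebra.ι k x * v) := by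
  rw [act, UniversalEnvelopingAlgebra.lift_ι_apply]
  rfl

theorem smul_tmul (f g : A) (v : UniversalEnvelopingAlgebra k L) :
    f • tmul ρ g v = tmul ρ (f * g) v := rfl

theorem act_ι_smul (x : L) (g : A) (y : SmashProduct ρ) :
    act ρ (UniversalEnvelopingAlgebra.ι k x) (g • y) =
      ρ x g • y + g • act ρ (UniversalEnvelopingAlgebra.ι k x) y := by
  induction y using induction_on with
  | h0 => simp
  | ht f u =>
    simp only [smul_tmul, act_ι_tmul, Derivation.leibniz, smul_eq_mul, smul_add]
    have h : tmul ρ (g * ρ x f + f * ρ x g) u = tmul ρ (g * ρ x f) u + tmul ρ (f * ρ x g) u :=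
      TensorProduct.add_tmul _ _ _
    rw [h, mul_comm f]
    abel
  | ha y z hy hz => rw [smul_add, map_add, hy, hz, map_add, smul_add, smul_add]; abel

theorem enveloping_induction {P : UniversalEnvelopingAlgebra k L → Prop}
    (hc : ∀ c : k, P (algebraMap k _ c)) (hι : ∀ x, P (UniversalEnvelopingAlgebra.ι k x))
    (hm : ∀ u v, P u → P v → P (u * v)) (ha : ∀ u v, P u → P v → P (u + v))
    (u : UniversalEnvelopingAlgebra k L) : P u := by
  obtain ⟨t, rfl⟩ := RingCon.mk'_surjective _ u
  induction t using TensorAlgebra.induction with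
  | algebraMap c => exact hc c
  | ι x => exact hι x
  | mul a b h1 h2 => rw [map_mul]; exact hm _ _ h1 h2
  | add a b h1 h2 => rw [map_add]; exact ha _ _ h1 h2

theorem smul_mul_assoc' (f : A) (x y : SmashProduct ρ) : (f • x) * y = f • (x * y) := by
  induction x using induction_on with
  | h0 => simp [mul_def]
  | ht g u => rw [smul_tmul, tmul_mul, tmul_mul, mul_smul]
  | ha x z hx hz =>
    rw [smul_add, mul_def, map_add, LinearMap.add_apply, ← mul_def, ← mul_def, hx, hz,
      mul_def (x + z), map_add, LinearMap.add_apply, smul_add]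
    rfl

theorem act_mul_assoc (u : UniversalEnvelopingAlgebra k L) (x y : SmashProduct ρ) :
    act ρ u x * y = act ρ u (x * y) := by
  induction u using enveloping_induction generalizing x y with
  | hc c => simp [mul_def]
  | hι z =>
    induction x using induction_on with
    | h0 => simp [mul_def]
    | ht g v =>
      rw [act_ι_tmul, mul_def, map_add, LinearMap.add_apply, ← mul_def, ← mul_def, tmul_mul,
        tmul_mul, tmul_mul, act_ι_smul, map_mul]
      rfl
    | ha x w hx hw =>
      rw [map_add, mul_def, map_add, LinearMap.add_apply, ← mul_def, ← mul_def, hx, hw,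
        mul_def (x + w), map_add, LinearMap.add_apply, map_add]
      rfl
  | hm a b h1 h2 => rw [map_mul, Module.End.mul_apply, h1, h2, Module.End.mul_apply]
  | ha a b h1 h2 =>
    rw [map_add, LinearMap.add_apply, mul_def, map_add, LinearMap.add_apply, ← mul_def,
      ← mul_def, h1, h2, LinearMap.add_apply]

instance : Ring (SmashProduct ρ) :=
  { (inferInstance : AddCommGroup (SmashProduct ρ)) with
    mul := (· * ·)
    one := 1
    left_distrib := fun x y z => map_add (mulHom ρ x) y z
    right_distrib := fun x y z => by
      rw [mul_def, map_add, LinearMap.add_apply]; rfl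
    zero_mul := fun x => by rw [mul_def, map_zero, LinearMap.zero_apply]
    mul_zero := fun x => map_zero (mulHom ρ x)
    mul_assoc := fun x y z => by
      induction x using induction_on with
      | h0 => simp [mul_def]
      | ht f u => rw [tmul_mul, tmul_mul, smul_mul_assoc', act_mul_assoc]
      | ha x w hx hw =>
        simp only [mul_def, map_add, LinearMap.add_apply] at hx hw ⊢
        rw [hx, hw]
    one_mul := fun x => by
      change tmul ρ 1 1 * x = x
      rw [tmul_mul, map_one, one_smul, Module.End.one_apply]
    mul_one := fun x => by
      change x * tmul ρ 1 1 = x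
      have key : ∀ u v : UniversalEnvelopingAlgebra k L,
          act ρ u (tmul ρ 1 v) = tmul ρ 1 (u * v) := by
        intro u
        induction u using enveloping_induction with
        | hc c =>
          intro v
          rw [AlgHom.commutes, Module.algebraMap_end_apply, ← Algebra.smul_def]
          exact (TensorProduct.tmul_smul c (1 : A) v).symm
        | hι z =>
          intro v
          rw [act_ι_tmul, Derivation.map_one_eq_zero]
          have h : tmul ρ 0 v = 0 := TensorProduct.zero_tmul _ _
          rw [h, zero_add]
        | hm a b h1 h2 => intro v; rw [map_mul, Module.End.mul_apply, h2, h1, mul_assoc]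
        | ha a b h1 h2 =>
          intro v
          rw [map_add, LinearMap.add_apply, h1, h2, add_mul]
          exact (TensorProduct.tmul_add _ _ _).symm
      induction x using induction_on with
      | h0 => rw [mul_def, map_zero, LinearMap.zero_apply]
      | ht f u => rw [tmul_mul, key, smul_tmul, mul_one, mul_one]
      | ha x y hx hy =>
        rw [mul_def, map_add, LinearMap.add_apply]
        exact congrArg₂ (· + ·) hx hy }

instance : Algebra k (SmashProduct ρ) :=
  Algebra.ofModule
    (fun c x y => by
      change mulHom ρ (c • x) y = c • mulHom ρ x y
      rw [map_smul, LinearMap.smul_apply])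
    (fun c x y => (mulHom ρ x).map_smul c y)

variable {B : Type*} [Ring B] [Algebra k B]

/-- A homomorphism out of `A # U(L)` from compatible homomorphisms out of `A` and `L`,
`f # u ↦ α(f) φ(u)`; compatible means `φ(x) α(f) = α(x(f)) + α(f) φ(x)`. -/
def lift (α : A →ₐ[k] B) (φ : L →ₗ⁅k⁆ B)
    (h : ∀ x f, φ x * α f = α (ρ x f) + α f * φ x) : SmashProduct ρ →ₐ[k] B :=
  AlgHom.ofLinearMap
    (TensorProduct.lift ((LinearMap.mul k B).compl₁₂ α.toLinearMap
      (UniversalEnvelopingAlgebra.lift k φ).toLinearMap) :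
        A ⊗[k] UniversalEnvelopingAlgebra k L →ₗ[k] B)
    (by
      change α 1 * UniversalEnvelopingAlgebra.lift k φ 1 = 1
      rw [map_one, map_one, mul_one])
    (by
      set F : SmashProduct ρ →ₗ[k] B := (TensorProduct.lift ((LinearMap.mul k B).compl₁₂
        α.toLinearMap (UniversalEnvelopingAlgebra.lift k φ).toLinearMap) :
          A ⊗[k] UniversalEnvelopingAlgebra k L →ₗ[k] B) with hF
      have Ft : ∀ f u, F (tmul ρ f u) = α f * UniversalEnvelopingAlgebra.lift k φ u :=
        fun f u => rfl
      have Fs : ∀ (f : A) (y : SmashProduct ρ), F (f • y) = α f * F y := by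
        intro f y
        induction y using induction_on with
        | h0 => simp
        | ht g v => rw [smul_tmul, Ft, Ft, map_mul, mul_assoc]
        | ha y z hy hz => rw [smul_add, map_add, hy, hz, map_add, mul_add]
      have Fa : ∀ (u : UniversalEnvelopingAlgebra k L) (y : SmashProduct ρ),
          F (act ρ u y) = UniversalEnvelopingAlgebra.lift k φ u * F y := by
        intro u
        induction u using enveloping_induction with
        | hc c =>
          intro y
          rw [AlgHom.commutes, AlgHom.commutes, Module.algebraMap_end_apply, map_smul,
            Algebra.smul_def]
        | hι x =>
          intro y
          induction y using induction_on with
          | h0 => simp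
          | ht g v =>
            rw [act_ι_tmul, map_add, Ft, Ft, Ft, map_mul,
              UniversalEnvelopingAlgebra.lift_ι_apply, ← mul_assoc, ← mul_assoc, h, add_mul]
          | ha y z hy hz => rw [map_add, map_add, hy, hz, map_add, mul_add]
        | hm a b h1 h2 => intro y; rw [map_mul, Module.End.mul_apply, h1, h2, map_mul, mul_assoc]
        | ha a b h1 h2 =>
          intro y
          rw [map_add, LinearMap.add_apply, map_add, h1, h2, map_add, add_mul]
      intro x y
      change F (x * y) = F x * F y
      induction x using induction_on with
      | h0 => rw [zero_mul, map_zero, zero_mul]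
      | ht f u => rw [tmul_mul, Fs, Fa, Ft, mul_assoc]
      | ha x z hx hz => rw [add_mul, map_add, hx, hz, map_add, add_mul])

theorem lift_tmul (α : A →ₐ[k] B) (φ : L →ₗ⁅k⁆ B)
    (h : ∀ x f, φ x * α f = α (ρ x f) + α f * φ x) (f : A)
    (u : UniversalEnvelopingAlgebra k L) :
    lift α φ h (tmul ρ f u) = α f * UniversalEnvelopingAlgebra.lift k φ u := rfl

variable (ρ)

/-- The inclusion `f ↦ f # 1` of `A`. -/
def ofAlgebra : A →ₐ[k] SmashProduct ρ :=
  AlgHom.ofLinearMap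
    ((TensorProduct.mk k A (UniversalEnvelopingAlgebra k L)).flip 1 :
      A →ₗ[k] A ⊗[k] UniversalEnvelopingAlgebra k L) rfl
    (by
      intro f g
      change tmul ρ (f * g) 1 = tmul ρ f 1 * tmul ρ g 1
      rw [tmul_mul, map_one, Module.End.one_apply, smul_tmul])

theorem ofAlgebra_apply (f : A) : ofAlgebra ρ f = tmul ρ f 1 := rfl

theorem ι_mul (x : L) (y : SmashProduct ρ) :
    tmul ρ 1 (UniversalEnvelopingAlgebra.ι k x) * y =
      act ρ (UniversalEnvelopingAlgebra.ι k x) y := by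
  rw [tmul_mul, one_smul]

/-- The inclusion `x ↦ 1 # x` of `L`. -/
def ofLie : L →ₗ⁅k⁆ SmashProduct ρ where
  toLinearMap := (TensorProduct.mk k A (UniversalEnvelopingAlgebra k L) 1 ∘ₗ
    (UniversalEnvelopingAlgebra.ι k : L →ₗ⁅k⁆ UniversalEnvelopingAlgebra k L).toLinearMap :
      L →ₗ[k] A ⊗[k] UniversalEnvelopingAlgebra k L)
  map_lie' {x y} := by
    change tmul ρ 1 (UniversalEnvelopingAlgebra.ι k ⁅x, y⁆) =
      tmul ρ 1 (UniversalEnvelopingAlgebra.ι k x) * tmul ρ 1 (UniversalEnvelopingAlgebra.ι k y) -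
      tmul ρ 1 (UniversalEnvelopingAlgebra.ι k y) * tmul ρ 1 (UniversalEnvelopingAlgebra.ι k x)
    have h0 : ∀ v, tmul ρ 0 v = 0 := fun v => TensorProduct.zero_tmul _ _
    rw [ι_mul, ι_mul, act_ι_tmul, act_ι_tmul, Derivation.map_one_eq_zero,
      Derivation.map_one_eq_zero, h0, h0, zero_add, zero_add, LieHom.map_lie,
      LieRing.of_associative_ring_bracket]
    exact TensorProduct.tmul_sub _ _ _

theorem ofLie_apply (x : L) : ofLie ρ x = tmul ρ 1 (UniversalEnvelopingAlgebra.ι k x) := rfl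

theorem ofLie_mul_ofAlgebra (x : L) (f : A) :
    ofLie ρ x * ofAlgebra ρ f = ofAlgebra ρ (ρ x f) + ofAlgebra ρ f * ofLie ρ x := by
  rw [ofLie_apply, ofAlgebra_apply, ofAlgebra_apply, ι_mul, act_ι_tmul, tmul_mul, map_one,
    Module.End.one_apply, smul_tmul, mul_one, mul_one]

end SmashProduct

end Smash

/-! ## Induced modules -/

section Induced

variable {k C B U : Type*} [CommRing k] [Ring C] [Algebra k C] [Ring B] [Algebra k B]
  [AddCommGroup U] [Module k U]

/-- For a homomorphism `φ : C → B` of `k`-algebras and a `C`-module `U` with structure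
homomorphism `τ`, the `B`-submodule of `B ⊗ₖ U` generated by all `b φ(c) ⊗ u - b ⊗ c u`. -/
def inducedRelations (φ : C →ₐ[k] B) (τ : C →ₐ[k] Module.End k U) : Submodule B (B ⊗[k] U) :=
  Submodule.span B {z | ∃ (b : B) (c : C) (u : U), z = (b * φ c) ⊗ₜ[k] u - b ⊗ₜ[k] τ c u}

/-- The induced `B`-module `B ⊗_C U`. -/
abbrev InducedModule (φ : C →ₐ[k] B) (τ : C →ₐ[k] Module.End k U) : Type _ :=
  (B ⊗[k] U) ⧸ inducedRelations φ τ

end Induced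

/-! ## Rudakov modules -/

section Rudakov

variable {k A : Type*} [Field k] [CommRing A] [Algebra k A]

variable (k A) in
/-- The algebra `A𝒱 = A # U(𝒱)`, where `𝒱 = Der A`. -/
abbrev AV : Type _ :=
  SmashProduct (LieHom.id : Derivation k A A →ₗ⁅k⁆ Derivation k A A)

/-- The algebra `A # U(𝒱₊)`. -/
abbrev AVPlus (ε : A →ₐ[k] k) : Type _ := SmashProduct (vanishingFields ε 0).incl

/-- The homomorphism `A # U(𝒱₊) → A # U(𝒱)` induced by the inclusion of `𝒱₊` in `𝒱`. -/
def avPlusIncl (ε : A →ₐ[k] k) : AVPlus ε →ₐ[k] AV k A :=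
  SmashProduct.lift (SmashProduct.ofAlgebra LieHom.id)
    ((SmashProduct.ofLie LieHom.id).comp (vanishingFields ε 0).incl)
    fun x f => SmashProduct.ofLie_mul_ofAlgebra LieHom.id (x : Derivation k A A) f

variable (ε : A →ₐ[k] k) (U : Type*) [AddCommGroup U] [Module k U]
  [LieRingModule (LinearFields ε) U] [LieModule k (LinearFields ε) U]

/-- The action of `A # U(𝒱₊)` on a `𝒱₊ / 𝒱(1)`-module `U`: a function `f` acts by the scalar
`f(p)`, and `𝒱₊` acts through its quotient. -/
def avPlusAction : AVPlus ε →ₐ[k] Module.End k U :=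
  SmashProduct.lift ((Algebra.ofId k (Module.End k U)).comp ε)
    ((LieModule.toEnd k (LinearFields ε) U).comp (linearFieldsMk ε))
    fun x f => by
      have h : ε ((x : Derivation k A A) f) = 0 := vanishingFields_zero_apply_mem x.2 f
      have h' : ε ((vanishingFields ε 0).incl x f) = 0 := h
      rw [AlgHom.comp_apply, AlgHom.comp_apply, h', map_zero, zero_add]
      exact (Algebra.commutes (ε f) _).symm

/-- The Rudakov module `R_p(U) = A # U(𝒱) ⊗_{A # U(𝒱₊)} U`. -/
abbrev RudakovModule : Type _ := InducedModule (avPlusIncl ε) (avPlusAction ε U)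

end Rudakov

end

/-! At a regular point p, generators x_1, …, x_s of the maximal ideal of the local ring B have
differentials forming a B-basis of Ω[B⁄k]. They span by Nakayama. They are independent because Ω has
dimension at least s over the fraction field, by Noether normalization and separability in
characteristic 0. The dual basis gives partial derivatives ∂_i of B; after clearing denominators and
rescaling, vector fields on X take the same values at p. This is `nonempty_localCoordinates`, and
the rest of the argument at p works from these coordinates.

A field in 𝒱₊ preserves 𝔪_p and 𝔪_p², so it acts on 𝔪_p/𝔪_p², which has basis x_1, …, x_s. The
kernel of this action is 𝒱(1), and the matrix M comes from ∑ M_ij x_i ∂_j. Hence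
`linearFieldsEquiv`.

For simplicity, let F_r be the part of the Rudakov module reached from U by fewer than r vector
fields. Functions in 𝔪_p send F_{r+1} to F_r, and the Euler operator ∑ ∂_i x_i acts on F_{r+1}/F_r
as -r (`euler_smul_add_nsmul_mem`). Let w ≠ 0 lie in F_{r+1} and in a submodule N, with r > 0.
Either some function in 𝔪_p moves w to a non-zero element of N in F_r, or 𝔪_p kills w; then r w lies
in F_r, and so does w. Descending, N meets the image of U (`exists_apply_mem_submodule`); since U is
irreducible and generates, N is everything.

This leaves the non-vanishing of the Rudakov module. Instead of a PBW basis,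
`nontrivial_rudakovModule` uses the A𝒱-module of linear maps B → U, on which fields act by Lie
derivatives. The delta functions at p form a copy of U stable under A # U(𝒱₊), so the universal
property gives a non-zero map from the induced module. -/

noncomputable section

/-! ### Dimension and Kähler differentials -/

section Dimension

open KaehlerDifferential

theorem ringKrullDim_le_of_isIntegral (R S : Type*) [CommRing R] [CommRing S] [Algebra R S]
    [Algebra.IsIntegral R S] : ringKrullDim S ≤ ringKrullDim R :=
  Order.krullDim_le_of_strictMono (PrimeSpectrum.comap (algebraMap R S)) fun I J h =>
    Ideal.IsIntegral.comap_lt_comap (I := I.asIdeal) (J := J.asIdeal) h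

/-- Noether normalization makes A integral over a polynomial ring P in r variables. In
characteristic 0 the algebraic extension K of Frac P is separable, hence formally étale, so Ω[K⁄k]
is the base change of Ω[P⁄k] and has dimension r. Integrality gives s ≤ r, which is all that is
needed. -/
theorem le_finrank_kaehlerDifferential_fractionField (k A K : Type*) [Field k] [CharZero k]
    [CommRing A] [IsDomain A] [Algebra k A] [Algebra.FiniteType k A] [Field K] [Algebra A K]
    [IsFractionRing A K] [Algebra k K] [IsScalarTower k A K] {s : ℕ}
    (hs : ringKrullDim A = s) : s ≤ Module.finrank K Ω[K⁄k] := by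
  obtain ⟨r, g, hg, hint⟩ := exists_integral_inj_algHom_of_fg k A
  let P := MvPolynomial (Fin r) k
  let F := FractionRing P
  let : Algebra P A := g.toRingHom.toAlgebra
  have : IsScalarTower k P A := .of_algebraMap_eq' g.comp_algebraMap.symm
  have : Algebra.IsIntegral P A := ⟨hint⟩
  have : FaithfulSMul P A := (faithfulSMul_iff_algebraMap_injective P A).2 hg
  let : Algebra P K := ((algebraMap A K).comp (algebraMap P A)).toAlgebra
  have : IsScalarTower P A K := .of_algebraMap_eq' rfl
  have : IsScalarTower k P K := .of_algebraMap_eq' (by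
    rw [IsScalarTower.algebraMap_eq P A K, RingHom.comp_assoc, ← IsScalarTower.algebraMap_eq k P A,
      ← IsScalarTower.algebraMap_eq])
  have : FaithfulSMul P K := (faithfulSMul_iff_algebraMap_injective P K).2 (by
    rw [IsScalarTower.algebraMap_eq P A K]
    exact (IsFractionRing.injective A K).comp hg)
  let : Algebra F K := FractionRing.liftAlgebra P K
  have : IsScalarTower P F K := FractionRing.isScalarTower_liftAlgebra P K
  have : CharZero P := charZero_of_injective_algebraMap (algebraMap k P).injective
  have : CharZero F := charZero_of_injective_algebraMap (IsFractionRing.injective P F)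
  have : Algebra.IsAlgebraic P K := by
    have : Algebra.IsAlgebraic A K := IsLocalization.isAlgebraic K (nonZeroDivisors A)
    exact Algebra.IsAlgebraic.trans P A K
  have : Algebra.IsAlgebraic F K := .extendScalars (IsFractionRing.injective P F)
  have : Algebra.FormallyEtale P F := .of_isLocalization (nonZeroDivisors P)
  have : Algebra.FormallyEtale F K := .of_isSeparable F K
  have : Algebra.FormallyEtale P K := .comp P F K
  have hr : Module.finrank K Ω[K⁄k] = r := by
    rw [← (tensorKaehlerEquivOfFormallyEtale k P K).finrank_eq,
      Module.finrank_eq_card_basis ((mvPolynomialBasis k (Fin r)).baseChange K), Fintype.card_fin]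
  have h := ringKrullDim_le_of_isIntegral P A
  rw [hs, MvPolynomial.ringKrullDim_of_isNoetherianRing, ringKrullDim_eq_zero_of_field, zero_add,
    Nat.card_fin] at h
  rw [hr]
  exact_mod_cast h

/-- If the maximal ideal of a local ring with residue field `k` is generated by the `x i`, then
the differentials `d x i` generate the module of differentials. -/
theorem span_range_kaehlerDifferential_D {k B ι : Type*} [Field k] [CommRing B] [IsLocalRing B]
    [Algebra k B] [Algebra.EssFiniteType k B] (ε : B →ₐ[k] k)
    (hε : ∀ b, ε b = 0 → b ∈ IsLocalRing.maximalIdeal B) (x : ι → B)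
    (hx : IsLocalRing.maximalIdeal B = Ideal.span (Set.range x)) :
    Submodule.span B (Set.range fun i => D k B (x i)) = ⊤ := by
  rw [eq_top_iff]
  refine Submodule.le_of_le_smul_of_le_jacobson_bot (I := IsLocalRing.maximalIdeal B)
    Module.Finite.fg_top (IsLocalRing.maximalIdeal_le_jacobson ⊥) ?_
  rw [← KaehlerDifferential.span_range_derivation, Submodule.span_le]
  rintro _ ⟨b, rfl⟩
  -- Nakayama input: D(a c) = a D(c) + c D(a), and the second term lies in 𝔪 Ω when c ∈ 𝔪.
  -- Subtracting its value from b puts b in 𝔪 without changing D(b).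
  have key : ∀ c ∈ Ideal.span (Set.range x), D k B c ∈
      Submodule.span B (Set.range fun i => D k B (x i)) ⊔
        IsLocalRing.maximalIdeal B • (Submodule.span B (Set.range (D k B))) := by
    intro c hc
    induction hc using Submodule.span_induction with
    | mem c h =>
      obtain ⟨i, rfl⟩ := h
      exact Submodule.mem_sup_left (Submodule.subset_span ⟨i, rfl⟩)
    | zero => rw [map_zero]; exact Submodule.zero_mem _
    | add a b _ _ ha hb => rw [map_add]; exact Submodule.add_mem _ ha hb
    | smul a c hc h =>
      rw [smul_eq_mul, Derivation.leibniz]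
      refine Submodule.add_mem _ (Submodule.smul_mem _ _ h) (Submodule.mem_sup_right ?_)
      exact Submodule.smul_mem_smul (hx ▸ hc) (Submodule.subset_span ⟨a, rfl⟩)
  have h : b - algebraMap k B (ε b) ∈ Ideal.span (Set.range x) := by
    rw [← hx]
    apply hε
    rw [map_sub, AlgHom.commutes, Algebra.algebraMap_self, RingHom.id_apply, sub_self]
  have h2 := key _ h
  rwa [map_sub, Derivation.map_algebraMap, sub_zero] at h2

/-- After passing to the fraction field, s vectors span a space of dimension at least s, so they are
independent over K and therefore over B. -/
theorem linearIndependent_D_of_span_eq_top {k B K : Type*} [Field k] [CommRing B]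
    [IsDomain B] [Algebra k B] [Field K] [Algebra B K] [IsFractionRing B K] [Algebra k K]
    [IsScalarTower k B K] {s : ℕ} (x : Fin s → B) (hs : s ≤ Module.finrank K Ω[K⁄k])
    (hx : Submodule.span B (Set.range fun i => D k B (x i)) = ⊤) :
    LinearIndependent B fun i => D k B (x i) := by
  have hspan : ⊤ ≤ Submodule.span K (Set.range fun i => D k K (algebraMap B K (x i))) := by
    rw [← span_range_map_derivation_of_isLocalization k B K (nonZeroDivisors B),
      Submodule.span_le]
    rintro _ ⟨b, rfl⟩
    have hb : D k B b ∈ Submodule.span B (Set.range fun i => D k B (x i)) := hx ▸ trivial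
    have h := Submodule.mem_map_of_mem (f := KaehlerDifferential.map k k B K) hb
    rw [Submodule.map_span, ← Set.range_comp] at h
    have h2 := Submodule.span_le_restrictScalars B K _ h
    simpa [Function.comp_def] using h2
  have hK := linearIndependent_of_top_le_span_of_card_le_finrank hspan (by simpa using hs)
  have hB := hK.restrict_scalars' B
  refine LinearIndependent.of_comp (KaehlerDifferential.map k k B K) ?_
  simpa [Function.comp_def] using hB

end Dimension

/-! ### Local coordinates at a non-singular point -/

section Coordinates

open KaehlerDifferential

variable {k A : Type*} [Field k] [CommRing A] [Algebra k A]

/-- Local coordinates of the variety with function algebra `A` at the point `ε`. They live on an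
`A`-algebra `B`, which stands for the local ring of the point. -/
structure LocalCoordinates (ε : A →ₐ[k] k) (B : Type*) [CommRing B] [Algebra k B] [Algebra A B]
    [IsScalarTower k A B] (s : ℕ) where
  /-- The local parameters. -/
  x : Fin s → A
  /-- Evaluation at the point on the local ring. -/
  eval : B →ₐ[k] k
  /-- The partial derivatives, as derivations of the local ring. -/
  der : Fin s → Derivation k B B
  /-- Vector fields with the same value at the point as the partial derivatives. -/
  field : Fin s → Derivation k A A
  eval_algebraMap : ∀ f, eval (algebraMap A B f) = ε f
  ε_x : ∀ i, ε (x i) = 0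
  der_x : ∀ i j, der i (algebraMap A B (x j)) = if i = j then 1 else 0
  ε_field : ∀ i f, ε (field i f) = eval (der i (algebraMap A B f))
  sub_mem : ∀ f, ε f = 0 → ∃ c : Fin s → k, f - ∑ i, c i • x i ∈ pointIdeal ε ^ 2
  algebraMap_apply : ∀ (η : Derivation k A A) (f : A),
    algebraMap A B (η f) = ∑ i, algebraMap A B (η (x i)) * der i (algebraMap A B f)
  apply_eq : ∀ (η : Derivation k B B) (f : B), η f = ∑ i, η (algebraMap A B (x i)) * der i f

theorem derivation_eq_sum_coord {B : Type*} [CommRing B] [Algebra k B] {ι : Type*} [Fintype ι]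
    (b : Module.Basis ι B Ω[B⁄k]) (y : ι → B) (hb : ∀ i, b i = D k B (y i))
    {M : Type*} [AddCommGroup M] [Module k M] [Module B M] [IsScalarTower k B M]
    (η : Derivation k B M) (f : B) : η f = ∑ i, b.coord i (D k B f) • η (y i) := by
  conv_lhs => rw [← Derivation.liftKaehlerDifferential_comp_D η f, ← b.sum_repr (D k B f)]
  simp only [map_sum, map_smul, hb, Derivation.liftKaehlerDifferential_comp_D, b.coord_apply]

/-- A derivation of B restricted to A is a linear map Ω[A⁄k] → B. Finite presentation of Ω[A⁄k]
supplies one common denominator t, and t η then takes values coming from A. -/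
theorem exists_derivation_of_isLocalization [Module.FinitePresentation A Ω[A⁄k]]
    (M : Submonoid A) (B : Type*) [CommRing B] [Algebra k B] [Algebra A B]
    [IsScalarTower k A B] [IsLocalization M B] (η : Derivation k B B) :
    ∃ (ξ : Derivation k A A) (t : M), ∀ f,
      algebraMap A B (ξ f) = algebraMap A B t * η (algebraMap A B f) := by
  obtain ⟨h, t, ht⟩ := Module.FinitePresentation.exists_lift_of_isLocalizedModule M
    (Algebra.linearMap A B) (η.compAlgebraMap A).liftKaehlerDifferential
  refine ⟨h.compDer (D k A), t, fun f => ?_⟩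
  have := LinearMap.congr_fun ht (D k A f)
  simpa [Algebra.smul_def, Submonoid.smul_def] using this

/-- A derivation of `A` extends to localizations of `A`. -/
theorem exists_extend_derivation_of_formallyEtale (B : Type*) [CommRing B] [Algebra k B]
    [Algebra A B] [IsScalarTower k A B] [Algebra.FormallyEtale A B] (η : Derivation k A A) :
    ∃ ξ : Derivation k B B, ∀ f, ξ (algebraMap A B f) = algebraMap A B (η f) := by
  let l : Ω[A⁄k] →ₗ[A] B := (Algebra.linearMap A B).comp η.liftKaehlerDifferential
  refine ⟨((isBaseChange_of_formallyEtale k A B).lift l).compDer (D k B), fun f => ?_⟩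
  have h := (isBaseChange_of_formallyEtale k A B).lift_eq l (D k A f)
  rw [KaehlerDifferential.map_D] at h
  simpa [l] using h

/-- Modulo 𝔪_p², t is a unit: t/ε(t) = 1 - v with v ∈ 𝔪_p, and (1 + v)(1 - v) = 1 - v². -/
theorem mem_sq_of_mul_mem_sq (ε : A →ₐ[k] k) {t g : A} (ht : ε t ≠ 0)
    (h : t * g ∈ pointIdeal ε ^ 2) : g ∈ pointIdeal ε ^ 2 := by
  set v : A := 1 - (ε t)⁻¹ • t with hv
  have hvm : v ∈ pointIdeal ε := by
    change ε v = 0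
    rw [hv, map_sub, map_one, map_smul, smul_eq_mul, inv_mul_cancel₀ ht, sub_self]
  have h1 : v ^ 2 * g ∈ pointIdeal ε ^ 2 := Ideal.mul_mem_right _ _ (Ideal.pow_mem_pow hvm 2)
  have h2 : g = v ^ 2 * g + (ε t)⁻¹ • ((1 + v) * (t * g)) := by
    have : (ε t)⁻¹ • ((1 + v) * (t * g)) = (1 + v) * ((ε t)⁻¹ • t) * g := by
      simp only [Algebra.smul_def]; ring
    rw [this, show (ε t)⁻¹ • t = 1 - v by rw [hv]; ring]
    ring
  rw [h2]
  exact Ideal.add_mem _ h1 (Submodule.smul_of_tower_mem _ _ (Ideal.mul_mem_left _ _ h))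

theorem mem_sq_of_algebraMap_mem_sq (ε : A →ₐ[k] k) (B : Type*) [CommRing B] [Algebra A B]
    [IsLocalization.AtPrime B (pointIdeal ε)] {g : A}
    (h : algebraMap A B g ∈ (Ideal.map (algebraMap A B) (pointIdeal ε)) ^ 2) :
    g ∈ pointIdeal ε ^ 2 := by
  rw [← Ideal.map_pow] at h
  obtain ⟨t, ht, htg⟩ := (IsLocalization.algebraMap_mem_map_algebraMap_iff
    (pointIdeal ε).primeCompl B _ _).1 h
  exact mem_sq_of_mul_mem_sq ε ht htg

/-- The maximal ideal of a regular point on a variety of dimension at most `s` is generated by `s`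
functions on the variety. -/
theorem exists_span_eq_maximalIdeal [IsNoetherianRing A] (q : Ideal A) [q.IsPrime] {s : ℕ}
    (hs : ringKrullDim A = s) (hq : IsRegularLocalRing (Localization.AtPrime q)) :
    ∃ x : Fin s → A, (∀ i, x i ∈ q) ∧
      IsLocalRing.maximalIdeal (Localization.AtPrime q) =
        Ideal.span (Set.range fun i => algebraMap A (Localization.AtPrime q) (x i)) := by
  set B := Localization.AtPrime q
  obtain ⟨S, hS, hspan⟩ := Submodule.FG.exists_span_finset_card_eq_spanFinrank
    (IsNoetherian.noetherian (IsLocalRing.maximalIdeal B))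
  -- By regularity, the least number of generators is dim B, which is the height of q and so at most
  -- dim A.
  have hle : S.card ≤ s := by
    have h1 := hq.spanFinrank_maximalIdeal
    have h2 : ringKrullDim B ≤ ringKrullDim A := by
      rw [IsLocalization.AtPrime.ringKrullDim_eq_height q B]
      exact Ideal.height_le_ringKrullDim_of_ne_top (Ideal.IsPrime.ne_top ‹_›)
    rw [← h1, hs, ← hS] at h2
    exact_mod_cast h2
  have hy : ∀ y : S, ∃ a ∈ q, Associated (y : B) (algebraMap A B a) := by
    rintro ⟨y, hy⟩
    obtain ⟨⟨a, t⟩, hat⟩ := IsLocalization.surj q.primeCompl y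
    have hu := IsLocalization.map_units B t
    have hym : y ∈ IsLocalRing.maximalIdeal B := by
      rw [← hspan]; exact Submodule.subset_span hy
    refine ⟨a, ?_, hu.unit, hat⟩
    rw [← IsLocalization.AtPrime.to_map_mem_maximal_iff B q a, ← hat]
    exact Ideal.mul_mem_right _ _ hym
  choose a haq hassoc using hy
  let e : Fin S.card ≃ S := S.equivFin.symm
  -- Only the bound `S.card ≤ s` is known here, so the family is padded with zeros to length s.
  refine ⟨fun i => if h : (i : ℕ) < S.card then a (e ⟨i, h⟩) else 0, fun i => ?_, ?_⟩
  · dsimp only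
    split_ifs
    · exact haq _
    · exact q.zero_mem
  · apply le_antisymm
    · rw [← hspan]
      refine Submodule.span_le.2 fun y hy => ?_
      obtain ⟨u, hu⟩ := (hassoc ⟨y, hy⟩).symm
      rw [show y = _ from hu.symm]
      refine Ideal.mul_mem_right _ _ (Submodule.subset_span
        ⟨⟨e.symm ⟨y, hy⟩, (e.symm ⟨y, hy⟩).2.trans_le hle⟩, ?_⟩)
      simp only [Fin.is_lt, dif_pos, Fin.eta, Equiv.apply_symm_apply]
      rfl
    · refine Ideal.span_le.2 ?_
      rintro _ ⟨i, rfl⟩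
      refine (IsLocalization.AtPrime.to_map_mem_maximal_iff B q _).2 ?_
      dsimp only
      split_ifs
      · exact haq _
      · exact q.zero_mem

theorem nonempty_localCoordinates [CharZero k] [IsDomain A] [Algebra.FiniteType k A]
    (ε : A →ₐ[k] k) {s : ℕ} (hs : ringKrullDim A = s) (hε : IsNonsingularPoint ε) :
    Nonempty (LocalCoordinates ε (Localization.AtPrime (pointIdeal ε)) s) := by
  have : IsNoetherianRing A := Algebra.FiniteType.isNoetherianRing k A
  obtain ⟨x, hxq, hx⟩ := exists_span_eq_maximalIdeal (pointIdeal ε) hs hε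
  set B := Localization.AtPrime (pointIdeal ε)
  let K := FractionRing A
  have : IsDomain B := IsLocalization.isDomain_localization (Ideal.primeCompl_le_nonZeroDivisors _)
  have : IsScalarTower k B K := .to₁₃₄ k A B K
  have : Algebra.FormallyEtale A B := .of_isLocalization (pointIdeal ε).primeCompl
  let eval : B →ₐ[k] k := IsLocalization.liftAlgHom (M := (pointIdeal ε).primeCompl) (f := ε)
    fun t => isUnit_iff_ne_zero.2 t.2
  have heval : ∀ f, eval (algebraMap A B f) = ε f := fun f => IsLocalization.lift_eq _ f
  have hmem : ∀ b, eval b = 0 → b ∈ IsLocalRing.maximalIdeal B := fun b hb =>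
    (IsLocalRing.mem_maximalIdeal b).2 fun hu => (hu.map eval).ne_zero hb
  have hspan := span_range_kaehlerDifferential_D eval hmem _ hx
  have hli := linearIndependent_D_of_span_eq_top (K := K) _
    (le_finrank_kaehlerDifferential_fractionField k A K hs) hspan
  let b := Module.Basis.mk hli hspan.ge
  have hb : ∀ i, b i = D k B (algebraMap A B (x i)) := fun i => Module.Basis.mk_apply _ _ i
  let der : Fin s → Derivation k B B := fun i => (b.coord i).compDer (D k B)
  have hder : ∀ (η : Derivation k B B) (f : B),
      η f = ∑ i, η (algebraMap A B (x i)) * der i f := fun η f => by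
    rw [derivation_eq_sum_coord b _ hb η f]
    exact Finset.sum_congr rfl fun i _ => mul_comm _ _
  have : Module.FinitePresentation A Ω[A⁄k] := Module.finitePresentation_of_finite A _
  choose ξ t ht using fun i =>
    exists_derivation_of_isLocalization (pointIdeal ε).primeCompl B (der i)
  have htε : ∀ i, ε (t i) ≠ 0 := fun i => (t i).2
  -- The field ξ_i restricts t_i ∂_i; dividing by the scalar ε(t_i) gives it the value of ∂_i at the
  -- point.
  refine ⟨⟨x, eval, der, fun i => (ε (t i))⁻¹ • ξ i, heval, hxq, fun i j => ?_, fun i f => ?_,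
    fun f hf => ?_, fun η f => ?_, hder⟩⟩
  · change b.coord i (D k B (algebraMap A B (x j))) = _
    rw [← hb, b.coord_apply, b.repr_self, Finsupp.single_apply]
    simp only [eq_comm]
  · rw [Derivation.smul_apply, map_smul, ← heval (ξ i f), ht, map_mul, heval, smul_eq_mul,
      inv_mul_cancel_left₀ (htε i)]
  · have hf' : algebraMap A B f ∈ Ideal.span (Set.range fun i => algebraMap A B (x i)) := by
      rw [← hx]
      exact hmem _ (by rw [heval, hf])
    obtain ⟨c, hc⟩ := (Ideal.mem_span_range_iff_exists_fun (R := B)).1 hf'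
    -- Replacing each coefficient c_i ∈ B by its value changes c_i x_i by an element of 𝔪², and
    -- membership in 𝔪² descends from B to A.
    refine ⟨fun i => eval (c i), mem_sq_of_algebraMap_mem_sq ε B ?_⟩
    rw [IsLocalization.AtPrime.map_eq_maximalIdeal (pointIdeal ε) B, map_sub, ← hc, map_sum,
      ← Finset.sum_sub_distrib, pow_two]
    refine Ideal.sum_mem _ fun i _ => ?_
    rw [Algebra.smul_def, map_mul, ← IsScalarTower.algebraMap_apply, ← sub_mul]
    refine Ideal.mul_mem_mul (hmem _ ?_) (hmem _ (by rw [heval]; exact hxq i))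
    rw [map_sub, AlgHom.commutes, Algebra.algebraMap_self, RingHom.id_apply, sub_self]
  · obtain ⟨η', hη'⟩ := exists_extend_derivation_of_formallyEtale B η
    rw [← hη', hder]
    simp only [hη']
    rfl

end Coordinates

/-! ### Linear parts of vector fields and 𝔤𝔩ₛ -/

section LinearPart

variable {k A : Type*} [Field k] [CommRing A] [Algebra k A] {ε : A →ₐ[k] k}

theorem derivation_sum_apply {M ι : Type*} [AddCommGroup M] [Module k M] [Module A M]
    (S : Finset ι) (η : ι → Derivation k A M) (f : A) : (∑ i ∈ S, η i) f = ∑ i ∈ S, η i f := by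
  rw [← Derivation.coeFnAddMonoidHom_apply, map_sum, Finset.sum_apply]
  rfl

theorem eval_derivation_apply_eq_zero_of_mem_sq (η : Derivation k A A) {g : A}
    (hg : g ∈ pointIdeal ε ^ 2) : ε (η g) = 0 := by
  rw [pow_two] at hg
  induction hg using Submodule.mul_induction_on' with
  | mem_mul_mem a ha b hb =>
    have ha' : ε a = 0 := ha
    have hb' : ε b = 0 := hb
    rw [Derivation.leibniz, smul_eq_mul, smul_eq_mul, map_add, map_mul, map_mul, ha', hb', zero_mul,
      zero_mul, add_zero]
  | add a _ b _ ha hb => rw [map_add, map_add, ha, hb, add_zero]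

namespace LocalCoordinates

variable {B : Type*} [CommRing B] [Algebra k B] [Algebra A B] [IsScalarTower k A B] {s : ℕ}
  (c : LocalCoordinates ε B s)

theorem ε_field_x (i j : Fin s) : ε (c.field i (c.x j)) = if i = j then 1 else 0 := by
  rw [c.ε_field, c.der_x]
  split_ifs <;> simp

/-- First-order Taylor expansion: applying `field j` to an expansion modulo 𝔪_p² and evaluating at
the point identifies the j-th coefficient, since derivations send 𝔪_p² into 𝔪_p. -/
theorem sub_sum_field_mem {g : A} (hg : ε g = 0) :
    g - ∑ i, ε (c.field i g) • c.x i ∈ pointIdeal ε ^ 2 := by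
  obtain ⟨a, ha⟩ := c.sub_mem g hg
  have h : ∀ j, ε (c.field j g) = a j := fun j => by
    have := eval_derivation_apply_eq_zero_of_mem_sq (c.field j) ha
    simp only [map_sub, map_sum, map_smul, Derivation.map_smul, c.ε_field_x, smul_eq_mul, mul_ite,
      mul_one, mul_zero, Finset.sum_ite_eq, Finset.mem_univ, if_true] at this
    exact sub_eq_zero.1 this
  simpa only [h] using ha

/-- The endomorphism of 𝔪_p/𝔪_p² induced by η, written in the basis x: the column of coefficients of
g is multiplied by the matrix `linearPart η`. Composition thus becomes matrix product, with no
transpose or sign, which is why `linearPart` respects brackets. -/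
theorem ε_field_apply {η : Derivation k A A} (hη : η ∈ vanishingFields ε 0) (i : Fin s) {g : A}
    (hg : ε g = 0) :
    ε (c.field i (η g)) = ∑ l, ε (c.field i (η (c.x l))) * ε (c.field l g) := by
  have h := eval_derivation_apply_eq_zero_of_mem_sq (c.field i)
    (vanishingFields_zero_apply_pow_mem hη 2 (c.sub_sum_field_mem hg))
  simp only [map_sub, map_sum, Derivation.map_smul, map_smul, smul_eq_mul, sub_eq_zero] at h
  rw [h]
  exact Finset.sum_congr rfl fun l _ => mul_comm _ _

/-- The linear part at the point of a vector field, as a matrix. -/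
def linearPart : Derivation k A A →ₗ[k] Matrix (Fin s) (Fin s) k where
  toFun η := .of fun i j => ε (c.field i (η (c.x j)))
  map_add' η ξ := by ext i j; simp
  map_smul' a η := by ext i j; simp

theorem linearPart_apply (η : Derivation k A A) (i j : Fin s) :
    c.linearPart η i j = ε (c.field i (η (c.x j))) := rfl

theorem linearPart_lie {η ξ : Derivation k A A} (hη : η ∈ vanishingFields ε 0)
    (hξ : ξ ∈ vanishingFields ε 0) :
    c.linearPart ⁅η, ξ⁆ = ⁅c.linearPart η, c.linearPart ξ⁆ := by
  ext i j
  rw [linearPart_apply, Derivation.commutator_apply, map_sub, map_sub,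
    c.ε_field_apply hη i (vanishingFields_zero_apply_mem hξ _),
    c.ε_field_apply hξ i (vanishingFields_zero_apply_mem hη _)]
  rfl

theorem linearPart_eq_zero_iff {η : Derivation k A A} (hη : η ∈ vanishingFields ε 0) :
    c.linearPart η = 0 ↔ η ∈ vanishingFields ε 1 := by
  constructor
  · intro h f
    have hx : ∀ j, η (c.x j) ∈ pointIdeal ε ^ 2 := fun j => by
      have h1 := c.sub_sum_field_mem (vanishingFields_zero_apply_mem hη (c.x j))
      have h2 : ∀ i, ε (c.field i (η (c.x j))) = 0 := fun i => congrFun (congrFun h i) j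
      simpa [h2] using h1
    have h0 : ε (f - algebraMap k A (ε f)) = 0 := by
      rw [map_sub, AlgHom.commutes, Algebra.algebraMap_self, RingHom.id_apply, sub_self]
    have h3 := vanishingFields_zero_apply_pow_mem hη 2 (c.sub_sum_field_mem h0)
    rw [map_sub, map_sub, Derivation.map_algebraMap, sub_zero, map_sum] at h3
    have h4 : ∑ i, η (ε (c.field i (f - algebraMap k A (ε f))) • c.x i) ∈ pointIdeal ε ^ 2 :=
      Ideal.sum_mem _ fun i _ => by
        rw [Derivation.map_smul]
        exact Submodule.smul_of_tower_mem _ _ (hx i)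
    exact (Submodule.sub_mem_iff_left _ h4).1 h3
  · intro h
    ext i j
    exact eval_derivation_apply_eq_zero_of_mem_sq _ (h _)

theorem exists_linearPart_eq (M : Matrix (Fin s) (Fin s) k) :
    ∃ η ∈ vanishingFields ε 0, c.linearPart η = M := by
  -- The linear vector field ∑ M_ij x_i ∂_j, with `field j` in the role of ∂_j.
  refine ⟨∑ i, ∑ j, M i j • c.x i • c.field j, ?_, ?_⟩
  · refine Submodule.sum_mem (vanishingFields ε 0).toSubmodule fun i _ =>
      Submodule.sum_mem _ fun j _ => Submodule.smul_mem _ _ fun f => ?_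
    rw [zero_add, pow_one, Derivation.smul_apply, smul_eq_mul]
    exact Ideal.mul_mem_right _ _ (c.ε_x i)
  · ext a b
    simp [linearPart_apply, derivation_sum_apply, Derivation.leibniz, c.ε_field_x, c.ε_x]

/-- Taking linear parts, as a homomorphism of Lie algebras. -/
def linearPartHom : vanishingFields ε 0 →ₗ⁅k⁆ Matrix (Fin s) (Fin s) k where
  toLinearMap := c.linearPart ∘ₗ (vanishingFields ε 0).toSubmodule.subtype
  map_lie' {η ξ} := c.linearPart_lie η.2 ξ.2

/-- The linear isomorphism underlying `linearFieldsEquiv`. -/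
def linearFieldsLinearEquiv : LinearFields ε ≃ₗ[k] Matrix (Fin s) (Fin s) k :=
  (Submodule.quotEquivOfEq _ _ (by
      ext η
      exact (c.linearPart_eq_zero_iff η.2).symm)).trans
    (LinearMap.quotKerEquivOfSurjective c.linearPartHom.toLinearMap fun M => by
      obtain ⟨η, hη, h⟩ := c.exists_linearPart_eq M
      exact ⟨⟨η, hη⟩, h⟩)

/-- The isomorphism `𝒱₊ / 𝒱(1) ≃ 𝔤𝔩ₛ`. -/
def linearFieldsEquiv : LinearFields ε ≃ₗ⁅k⁆ Matrix (Fin s) (Fin s) k where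
  __ := c.linearFieldsLinearEquiv
  map_lie' {a b} := by
    induction a using Submodule.Quotient.induction_on
    induction b using Submodule.Quotient.induction_on
    exact c.linearPartHom.map_lie _ _

theorem linearFieldsEquiv_mk (η : vanishingFields ε 0) :
    c.linearFieldsEquiv (linearFieldsMk ε η) = c.linearPart η := rfl

end LocalCoordinates

end LinearPart

/-! ### Matrices and derivations over B acting on linear maps B → U -/

section MatrixAction

variable {k B U : Type*} [Field k] [CommRing B] [Algebra k B] [AddCommGroup U] [Module k U]
  {s : ℕ}

/-- The operator `φ ↦ T ∘ φ ∘ (a * ·)` on linear maps `B → U`. -/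
def multiplierOp : B →ₗ[k] Module.End k U →ₗ[k] Module.End k (B →ₗ[k] U) :=
  LinearMap.mk₂ k (fun a T =>
    { toFun := fun φ => T ∘ₗ φ ∘ₗ LinearMap.mulLeft k a
      map_add' := fun φ ψ => by ext; simp
      map_smul' := fun r φ => by ext; simp })
    (fun a b T => by ext; simp [add_mul]) (fun r a T => by ext; simp)
    (fun a S T => by ext; simp) (fun r a T => by ext; simp)

theorem multiplierOp_apply (a : B) (T : Module.End k U) (φ : B →ₗ[k] U) (g : B) :
    multiplierOp a T φ g = T (φ (a * g)) := rfl

theorem lie_multiplierOp (a b : B) (S T : Module.End k U) :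
    ⁅multiplierOp a S, multiplierOp b T⁆ = multiplierOp (a * b) ⁅S, T⁆ := by
  ext φ g
  simp only [LieRing.of_associative_ring_bracket, LinearMap.sub_apply, Module.End.mul_apply,
    multiplierOp_apply]
  rw [← mul_assoc, ← mul_assoc, mul_comm b a]

variable (ρ : Matrix (Fin s) (Fin s) k →ₗ⁅k⁆ Module.End k U)

/-- The action of matrices over `B` on linear maps `B → U` induced by a representation of
`𝔤𝔩ₛ(k)` on `U`. -/
def matrixOp : Matrix (Fin s) (Fin s) B →ₗ[k] Module.End k (B →ₗ[k] U) :=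
  ∑ i, ∑ j, multiplierOp.flip (ρ (Matrix.single i j 1)) ∘ₗ Matrix.entryLinearMap k B i j

theorem matrixOp_apply (M : Matrix (Fin s) (Fin s) B) :
    matrixOp ρ M = ∑ i, ∑ j, multiplierOp (M i j) (ρ (Matrix.single i j 1)) := by
  simp [matrixOp]

theorem matrixOp_apply_apply (M : Matrix (Fin s) (Fin s) B) (φ : B →ₗ[k] U) (g : B) :
    matrixOp ρ M φ g = ∑ i, ∑ j, ρ (Matrix.single i j 1) (φ (M i j * g)) := by
  simp [matrixOp_apply, multiplierOp_apply]

theorem sum_map_single {N : Type*} [AddCommGroup N] [Module k N]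
    (f : Matrix (Fin s) (Fin s) k →ₗ[k] N) (X : Matrix (Fin s) (Fin s) k) :
    ∑ i, ∑ j, X i j • f (Matrix.single i j 1) = f X := by
  conv_rhs => rw [Matrix.matrix_eq_sum_single X]
  simp only [map_sum, ← map_smul, Matrix.smul_single, smul_eq_mul, mul_one]

theorem matrixOp_smul_map (a : B) (X : Matrix (Fin s) (Fin s) k) :
    matrixOp ρ (a • X.map (algebraMap k B)) = multiplierOp a (ρ X) := by
  rw [matrixOp_apply]
  refine Eq.trans ?_ (sum_map_single (multiplierOp a ∘ₗ ρ.toLinearMap) X)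
  refine Finset.sum_congr rfl fun i _ => Finset.sum_congr rfl fun j _ => ?_
  rw [Matrix.smul_apply, Matrix.map_apply, smul_eq_mul, mul_comm, ← Algebra.smul_def, map_smul]
  rfl

/-- 𝔤𝔩ₛ(B) = B ⊗ 𝔤𝔩ₛ(k), so additive identities need only be checked on pure tensors a X. -/
theorem matrix_scalar_induction {P : Matrix (Fin s) (Fin s) B → Prop}
    (M : Matrix (Fin s) (Fin s) B) (h0 : P 0) (hadd : ∀ M N, P M → P N → P (M + N))
    (h : ∀ (a : B) (X : Matrix (Fin s) (Fin s) k), P (a • X.map (algebraMap k B))) : P M := by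
  induction M using Matrix.induction_on' with
  | h_zero => exact h0
  | h_add M N hM hN => exact hadd M N hM hN
  | h_std_basis i j a =>
    convert h a (Matrix.single i j 1)
    ext
    simp [Matrix.single_apply]

/-- On pure tensors [aX, bY] = ab [X, Y], because B is commutative; the operators satisfy the same
rule by `lie_multiplierOp`. -/
theorem matrixOp_lie (M N : Matrix (Fin s) (Fin s) B) :
    matrixOp ρ ⁅M, N⁆ = ⁅matrixOp ρ M, matrixOp ρ N⁆ := by
  refine matrix_scalar_induction (k := k)
    (P := fun M => matrixOp ρ ⁅M, N⁆ = ⁅matrixOp ρ M, matrixOp ρ N⁆) M (by simp)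
    (fun M₁ M₂ h₁ h₂ => by simp only [add_lie, map_add, h₁, h₂]) fun a X => ?_
  refine matrix_scalar_induction (k := k) (P := fun N => matrixOp ρ ⁅a • X.map (algebraMap k B), N⁆ =
    ⁅matrixOp ρ (a • X.map (algebraMap k B)), matrixOp ρ N⁆) N (by simp)
    (fun N₁ N₂ h₁ h₂ => by simp only [lie_add, map_add, h₁, h₂]) fun b Y => ?_
  rw [matrixOp_smul_map, matrixOp_smul_map, lie_multiplierOp, ← LieHom.map_lie, ← matrixOp_smul_map]
  congr 1
  rw [← RingHom.mapMatrix_apply, ← RingHom.mapMatrix_apply, ← RingHom.mapMatrix_apply]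
  simp only [LieRing.of_associative_ring_bracket, smul_mul_assoc, mul_smul_comm, smul_smul,
    smul_sub, mul_comm b a, map_sub, map_mul]

/-- A derivation of `B` acts on linear maps `B → U` by `φ ↦ -φ ∘ η`. -/
def derivationOp : Derivation k B B →ₗ⁅k⁆ Module.End k (B →ₗ[k] U) where
  toFun η := -LinearMap.lcomp k U (η : B →ₗ[k] B)
  map_add' η ξ := by
    ext φ g
    change -φ ((η + ξ) g) = -φ (η g) + -φ (ξ g)
    rw [Derivation.add_apply, map_add, neg_add]
  map_smul' r η := by
    ext φ g
    change -φ ((r • η) g) = r • -φ (η g)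
    rw [Derivation.smul_apply, map_smul, smul_neg]
  map_lie' {η ξ} := by
    ext φ g
    change -φ (⁅η, ξ⁆ g) = - -φ (ξ (η g)) - - -φ (η (ξ g))
    rw [Derivation.commutator_apply, map_sub, neg_neg, neg_neg, neg_sub]

theorem derivationOp_apply (η : Derivation k B B) (φ : B →ₗ[k] U) (g : B) :
    derivationOp η φ g = -φ (η g) := rfl

theorem lie_derivationOp_matrixOp (η : Derivation k B B) (M : Matrix (Fin s) (Fin s) B) :
    ⁅(derivationOp η : Module.End k (B →ₗ[k] U)), matrixOp ρ M⁆ = matrixOp ρ (M.map η) := by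
  ext φ g
  simp only [LieRing.of_associative_ring_bracket, LinearMap.sub_apply, Module.End.mul_apply,
    derivationOp_apply, matrixOp_apply_apply, ← Finset.sum_neg_distrib, ← Finset.sum_sub_distrib,
    Matrix.map_apply]
  refine Finset.sum_congr rfl fun i _ => Finset.sum_congr rfl fun j _ => ?_
  rw [Derivation.leibniz, smul_eq_mul, smul_eq_mul, map_add, map_neg, map_add, mul_comm g]
  abel

end MatrixAction

/-! ### Lie derivatives and delta functions -/

theorem algebraMap_smul_tower {k A B : Type*} [CommSemiring k] [Semiring B] [CommSemiring A]
    [Algebra k A] [Algebra k B] [Algebra A B] [IsScalarTower k A B] (r : k) (f : A) :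
    algebraMap A B (r • f) = r • algebraMap A B f :=
  map_smul (IsScalarTower.toAlgHom k A B) r f

namespace LocalCoordinates

variable {k A : Type*} [Field k] [CommRing A] [Algebra k A] {ε : A →ₐ[k] k}
  {B : Type*} [CommRing B] [Algebra k B] [Algebra A B] [IsScalarTower k A B] {s : ℕ}
  (c : LocalCoordinates ε B s)

include c in
theorem derivation_ext {η ξ : Derivation k B B}
    (h : ∀ i, η (algebraMap A B (c.x i)) = ξ (algebraMap A B (c.x i))) : η = ξ := by
  ext f
  rw [c.apply_eq, c.apply_eq ξ]
  simp only [h]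

/-- The extension of vector fields to the local ring. -/
def extend : Derivation k A A →ₗ[k] Derivation k B B where
  toFun η := ∑ i, algebraMap A B (η (c.x i)) • c.der i
  map_add' η ξ := by simp [add_smul, Finset.sum_add_distrib]
  map_smul' r η := by
    simp only [Derivation.smul_apply, RingHom.id_apply, Finset.smul_sum]
    refine Finset.sum_congr rfl fun i _ => ?_
    rw [algebraMap_smul_tower, smul_assoc]

theorem extend_apply (η : Derivation k A A) (f : B) :
    c.extend η f = ∑ i, algebraMap A B (η (c.x i)) * c.der i f := by
  simp only [extend, LinearMap.coe_mk, AddHom.coe_mk, derivation_sum_apply, Derivation.smul_apply,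
    smul_eq_mul]

theorem extend_algebraMap (η : Derivation k A A) (f : A) :
    c.extend η (algebraMap A B f) = algebraMap A B (η f) := by
  rw [extend_apply, ← c.algebraMap_apply]

theorem extend_lie (η ξ : Derivation k A A) : c.extend ⁅η, ξ⁆ = ⁅c.extend η, c.extend ξ⁆ := by
  refine c.derivation_ext fun i => ?_
  simp only [Derivation.commutator_apply, extend_algebraMap, map_sub]

theorem eval_extend {η : Derivation k A A} (hη : η ∈ vanishingFields ε 0) (f : B) :
    c.eval (c.extend η f) = 0 := by
  rw [extend_apply, map_sum]
  refine Finset.sum_eq_zero fun i _ => ?_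
  rw [map_mul, c.eval_algebraMap, show ε _ = 0 from vanishingFields_zero_apply_mem hη _, zero_mul]

/-- The Jacobian matrix of a vector field. -/
def jacobian : Derivation k A A →ₗ[k] Matrix (Fin s) (Fin s) B where
  toFun η := .of fun i j => c.der i (algebraMap A B (η (c.x j)))
  map_add' η ξ := by ext; simp
  map_smul' r η := by ext; simp [algebraMap_smul_tower]

theorem jacobian_apply (η : Derivation k A A) (i j : Fin s) :
    c.jacobian η i j = c.der i (algebraMap A B (η (c.x j))) := rfl

theorem jacobian_map_eval (η : Derivation k A A) :
    (c.jacobian η).map c.eval = c.linearPart η := by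
  ext i j
  rw [Matrix.map_apply, jacobian_apply, linearPart_apply, c.ε_field]

theorem der_extend (η : Derivation k A A) (i : Fin s) (g : B) :
    c.der i (c.extend η g) = c.extend η (c.der i g) + ∑ l, c.jacobian η i l * c.der l g := by
  have h : ⁅c.der i, c.extend η⁆ = ∑ l, c.jacobian η i l • c.der l := by
    refine c.derivation_ext fun j => ?_
    rw [Derivation.commutator_apply, extend_algebraMap, c.der_x]
    have h0 : c.extend η (if i = j then (1 : B) else 0) = 0 := by split_ifs <;> simp
    simp [h0, derivation_sum_apply, c.der_x, jacobian_apply]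
  have h2 := DFunLike.congr_fun h g
  rw [Derivation.commutator_apply, sub_eq_iff_eq_add'] at h2
  simpa [derivation_sum_apply] using h2

/-- This cocycle identity says that η ↦ (`extend η`, `jacobian η`) is a homomorphism into the
semidirect product of Der B and 𝔤𝔩ₛ(B), so `fieldOp` is a Lie algebra action. It comes from the
commutator [∂_i, η] = ∑ J_il ∂_l in `der_extend`. -/
theorem jacobian_lie (η ξ : Derivation k A A) :
    c.jacobian ⁅η, ξ⁆ = (c.jacobian ξ).map (c.extend η) - (c.jacobian η).map (c.extend ξ) +
      ⁅c.jacobian η, c.jacobian ξ⁆ := by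
  ext i j
  rw [jacobian_apply, Derivation.commutator_apply, map_sub, map_sub,
    ← c.extend_algebraMap η (ξ (c.x j)), ← c.extend_algebraMap ξ (η (c.x j)), c.der_extend η,
    c.der_extend ξ]
  simp only [Matrix.add_apply, Matrix.sub_apply, Matrix.map_apply,
    LieRing.of_associative_ring_bracket, Matrix.mul_apply]
  simp only [jacobian_apply]
  abel

variable {U : Type*} [AddCommGroup U] [Module k U]
  (ρ : Matrix (Fin s) (Fin s) k →ₗ⁅k⁆ Module.End k U)

/-- The action of vector fields on linear maps `B → U`, given by Lie derivatives. -/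
def fieldOp : Derivation k A A →ₗ⁅k⁆ Module.End k (B →ₗ[k] U) where
  toLinearMap := (derivationOp : _ →ₗ⁅k⁆ Module.End k (B →ₗ[k] U)).toLinearMap ∘ₗ c.extend +
    matrixOp ρ ∘ₗ c.jacobian
  map_lie' {η ξ} := by
    change derivationOp (c.extend ⁅η, ξ⁆) + matrixOp ρ (c.jacobian ⁅η, ξ⁆) =
      ⁅derivationOp (c.extend η) + matrixOp ρ (c.jacobian η),
        derivationOp (c.extend ξ) + matrixOp ρ (c.jacobian ξ)⁆
    rw [extend_lie, LieHom.map_lie, jacobian_lie, map_add, map_sub, matrixOp_lie,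
      ← lie_derivationOp_matrixOp, ← lie_derivationOp_matrixOp, add_lie, lie_add, lie_add,
      ← lie_skew (matrixOp ρ (c.jacobian η)) (derivationOp (c.extend ξ))]
    abel

theorem fieldOp_apply (η : Derivation k A A) (φ : B →ₗ[k] U) (g : B) :
    c.fieldOp ρ η φ g = -φ (c.extend η g) + matrixOp ρ (c.jacobian η) φ g := rfl

variable (A B U) in
/-- The action of functions on linear maps `B → U`. -/
def functionOp (k : Type*) [Field k] [Algebra k A] [Algebra k B] [IsScalarTower k A B]
    [Module k U] : A →ₐ[k] Module.End k (B →ₗ[k] U) :=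
  AlgHom.ofLinearMap (multiplierOp.flip LinearMap.id ∘ₗ (IsScalarTower.toAlgHom k A B).toLinearMap)
    (by ext; simp [multiplierOp_apply])
    (fun f g => by
      ext φ h
      simp [multiplierOp_apply, mul_assoc, mul_left_comm])

theorem functionOp_apply (f : A) (φ : B →ₗ[k] U) (g : B) :
    functionOp A B U k f φ g = φ (algebraMap A B f * g) := rfl

/-- Linear maps `B → U` as an `A𝒱`-module. -/
def smashOp : AV k A →ₐ[k] Module.End k (B →ₗ[k] U) :=
  SmashProduct.lift (functionOp A B U k) (c.fieldOp ρ) fun η f => by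
    ext φ g
    simp only [Module.End.mul_apply, LinearMap.add_apply, fieldOp_apply, functionOp_apply,
      matrixOp_apply_apply, LieHom.id_apply, Derivation.leibniz, extend_algebraMap, smul_eq_mul,
      map_add, mul_left_comm (algebraMap A B f), mul_comm g]
    abel

/-- The delta function at the point with value `u`. -/
def delta : U →ₗ[k] B →ₗ[k] U := (LinearMap.lsmul k U).flip.compl₂ c.eval.toLinearMap

theorem delta_apply (u : U) (g : B) : c.delta u g = c.eval g • u := rfl

theorem functionOp_delta (f : A) (u : U) : functionOp A B U k f (c.delta u) = c.delta (ε f • u) := by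
  ext g
  rw [functionOp_apply, delta_apply, delta_apply, map_mul, c.eval_algebraMap, mul_comm, mul_smul]

/-- For η vanishing at the point, the transport term dies after evaluation and the Jacobian is seen
only through its value there, the linear part. -/
theorem fieldOp_delta {η : Derivation k A A} (hη : η ∈ vanishingFields ε 0) (u : U) :
    c.fieldOp ρ η (c.delta u) = c.delta (ρ (c.linearPart η) u) := by
  ext g
  rw [fieldOp_apply, delta_apply, c.eval_extend hη, zero_smul, neg_zero, zero_add,
    matrixOp_apply_apply, delta_apply, ← c.jacobian_map_eval]
  have h := sum_map_single (LinearMap.applyₗ u ∘ₗ ρ.toLinearMap) ((c.jacobian η).map c.eval)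
  refine Eq.trans ?_ (congrArg (c.eval g • ·) h)
  simp only [Finset.smul_sum, delta_apply, map_mul, map_smul, mul_smul, Matrix.map_apply]
  refine Finset.sum_congr rfl fun i _ => Finset.sum_congr rfl fun j _ => ?_
  exact smul_comm _ _ _

end LocalCoordinates

/-! ### Generators of the smash product -/

/-- The smash product is generated by `A` and `L`. -/
theorem SmashProduct.generator_induction {k A L : Type*} [CommRing k] [CommRing A] [Algebra k A]
    [LieRing L] [LieAlgebra k L] {ρ : L →ₗ⁅k⁆ Derivation k A A} {P : SmashProduct ρ → Prop}
    (hA : ∀ f, P (ofAlgebra ρ f)) (hL : ∀ x, P (ofLie ρ x))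
    (hm : ∀ a b, P a → P b → P (a * b)) (ha : ∀ a b, P a → P b → P (a + b))
    (b : SmashProduct ρ) : P b := by
  have hact : ∀ u, ∀ y, P y → P (act ρ u y) := by
    intro u
    induction u using enveloping_induction with
    | hc c =>
      intro y hy
      have h : act ρ (algebraMap k _ c) y = ofAlgebra ρ (algebraMap k A c) * y := by
        rw [AlgHom.commutes, AlgHom.commutes, Module.algebraMap_end_apply, Algebra.smul_def]
      rw [h]
      exact hm _ _ (hA _) hy
    | hι x =>
      intro y hy
      rw [← ι_mul]
      exact hm _ _ (hL x) hy
    | hm u v hu hv =>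
      intro y hy
      rw [map_mul]
      exact hu _ (hv y hy)
    | ha u v hu hv =>
      intro y hy
      rw [map_add, LinearMap.add_apply]
      exact ha _ _ (hu y hy) (hv y hy)
  induction b using SmashProduct.induction_on with
  | h0 => simpa using hA 0
  | ha x y hx hy => exact ha x y hx hy
  | ht f u =>
    have h : tmul ρ f u = ofAlgebra ρ f * act ρ u 1 := by
      rw [ofAlgebra_apply, tmul_mul, map_one, Module.End.one_apply, ← mul_one (tmul ρ f u), tmul_mul]
    rw [h]
    exact hm _ _ (hA f) (hact u _ (by simpa using hA 1))

/-- The inclusion of functions in `A𝒱`. -/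
abbrev AV.ofFunction (k A : Type*) [Field k] [CommRing A] [Algebra k A] : A →ₐ[k] AV k A :=
  SmashProduct.ofAlgebra LieHom.id

/-- The inclusion of vector fields in `A𝒱`. -/
abbrev AV.ofField {k A : Type*} [Field k] [CommRing A] [Algebra k A] :
    Derivation k A A →ₗ⁅k⁆ AV k A :=
  SmashProduct.ofLie LieHom.id

namespace LocalCoordinates

/-- Modulo 𝒱₊ a field is determined by its value at the point, and the fields `field i` realize a
basis of these values. -/
theorem sub_sum_field_mem_vanishingFields {k A : Type*} [Field k] [CommRing A] [Algebra k A]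
    {ε : A →ₐ[k] k} {B : Type*} [CommRing B] [Algebra k B] [Algebra A B] [IsScalarTower k A B]
    {s : ℕ} (c : LocalCoordinates ε B s) (η : Derivation k A A) :
    η - ∑ i, ε (η (c.x i)) • c.field i ∈ vanishingFields ε 0 := by
  intro f
  rw [zero_add, pow_one]
  change ε _ = 0
  have h := congrArg c.eval (c.algebraMap_apply η f)
  simp only [map_sum, map_mul, c.eval_algebraMap] at h
  simp [derivation_sum_apply, h, c.ε_field]

end LocalCoordinates

/-! ### The filtration, the Euler operator and simplicity -/

section Simplicity

open SmashProduct AV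

variable {k A : Type*} [Field k] [CommRing A] [Algebra k A]
  {U R : Type*} [AddCommGroup U] [AddCommGroup R] [Module (AV k A) R]

theorem function_field_smul (f : A) (η : Derivation k A A) (w : R) :
    ofFunction k A f • ofField η • w = ofField η • ofFunction k A f • w - ofFunction k A (η f) • w := by
  rw [smul_smul, smul_smul, ofLie_mul_ofAlgebra, add_smul]
  exact (add_sub_cancel_left _ _).symm

theorem field_field_smul (η ξ : Derivation k A A) (w : R) :
    ofField η • ofField ξ • w = ofField ξ • ofField η • w + ofField ⁅η, ξ⁆ • w := by
  rw [LieHom.map_lie, LieRing.of_associative_ring_bracket, sub_smul, smul_smul, smul_smul]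
  abel

variable (k A) in
/-- The elements of an `A𝒱`-module obtained by applying less than `r` vector fields to elements of
the image of `ι`. -/
def fieldFiltration (ι : U →+ R) : ℕ → AddSubgroup R
  | 0 => ⊥
  | r + 1 => ι.range ⊔
      AddSubgroup.closure {z | ∃ (η : Derivation k A A), ∃ w ∈ fieldFiltration ι r, z = ofField η • w}

variable {ι : U →+ R}

theorem field_smul_mem (η : Derivation k A A) {r : ℕ} {w : R} (hw : w ∈ fieldFiltration k A ι r) :
    ofField η • w ∈ fieldFiltration k A ι (r + 1) :=
  AddSubgroup.mem_sup_right (AddSubgroup.subset_closure ⟨η, w, hw, rfl⟩)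

theorem apply_mem_fieldFiltration (r : ℕ) (u : U) : ι u ∈ fieldFiltration k A ι (r + 1) :=
  AddSubgroup.mem_sup_left ⟨u, rfl⟩

@[elab_as_elim]
theorem fieldFiltration_induction {r : ℕ} {P : R → Prop} {w : R}
    (hw : w ∈ fieldFiltration k A ι (r + 1)) (hι : ∀ u, P (ι u))
    (hη : ∀ (η : Derivation k A A), ∀ w ∈ fieldFiltration k A ι r, P (ofField η • w))
    (hadd : ∀ v w, P v → P w → P (v + w)) (hneg : ∀ w, P w → P (-w)) : P w := by
  have h0 : P 0 := by simpa using hι 0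
  obtain ⟨_, ⟨u, rfl⟩, v, hv, rfl⟩ := AddSubgroup.mem_sup.1 hw
  refine hadd _ _ (hι u) ?_
  clear hw
  induction hv using AddSubgroup.closure_induction with
  | mem z hz =>
    obtain ⟨η, w, hw, rfl⟩ := hz
    exact hη η w hw
  | zero => exact h0
  | add a b _ _ h1 h2 => exact hadd _ _ h1 h2
  | neg a _ h => exact hneg _ h

theorem fieldFiltration_mono : Monotone (fieldFiltration k A ι) := by
  refine monotone_nat_of_le_succ fun r => ?_
  induction r with
  | zero => exact bot_le
  | succ r ih =>
    intro w hw
    exact fieldFiltration_induction hw (apply_mem_fieldFiltration _)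
      (fun η w hw => field_smul_mem η (ih hw)) (fun _ _ => AddSubgroup.add_mem _)
      fun _ => AddSubgroup.neg_mem _

theorem mem_fieldFiltration_zero {w : R} : w ∈ fieldFiltration k A ι 0 ↔ w = 0 := AddSubgroup.mem_bot

theorem mem_range_of_mem_fieldFiltration_one {w : R} (hw : w ∈ fieldFiltration k A ι 1) :
    ∃ u, ι u = w :=
  fieldFiltration_induction (P := fun w => ∃ u, ι u = w) hw (fun u => ⟨u, rfl⟩)
    (fun η w hw => ⟨0, by rw [mem_fieldFiltration_zero.1 hw, smul_zero, map_zero]⟩)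
    (fun _ _ ⟨a, ha⟩ ⟨b, hb⟩ => ⟨a + b, by rw [map_add, ha, hb]⟩)
    fun _ ⟨a, ha⟩ => ⟨-a, by rw [map_neg, ha]⟩

variable [Module k U] {ε : A →ₐ[k] k} (hA : ∀ f u, ofFunction k A f • ι u = ι (ε f • u))

include hA

theorem function_smul_mem (f : A) {r : ℕ} {w : R} (hw : w ∈ fieldFiltration k A ι r) :
    ofFunction k A f • w ∈ fieldFiltration k A ι r := by
  induction r generalizing f w with
  | zero => rw [mem_fieldFiltration_zero.1 hw, smul_zero]; exact AddSubgroup.zero_mem _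
  | succ r ih =>
    refine fieldFiltration_induction hw (fun u => ?_) (fun η w hw => ?_) (fun v w hv hw => ?_)
      fun w hw => ?_
    · rw [hA]; exact apply_mem_fieldFiltration r _
    · rw [function_field_smul]
      exact AddSubgroup.sub_mem _ (field_smul_mem η (ih f hw))
        (fieldFiltration_mono r.le_succ (ih _ hw))
    · rw [smul_add]; exact AddSubgroup.add_mem _ hv hw
    · rw [smul_neg]; exact AddSubgroup.neg_mem _ hw

/-- Moving f past a field η produces -η(f), one field fewer. When f has passed all of them it
reaches the image of ι, which it kills. As the zeroth step is 0, the bound also holds at the bottom.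
-/
theorem vanishing_function_smul_mem {f : A} (hf : ε f = 0) {r : ℕ} {w : R}
    (hw : w ∈ fieldFiltration k A ι (r + 1)) : ofFunction k A f • w ∈ fieldFiltration k A ι r := by
  induction r generalizing w with
  | zero =>
    obtain ⟨u, rfl⟩ := mem_range_of_mem_fieldFiltration_one hw
    rw [hA, hf, zero_smul, map_zero]
    exact AddSubgroup.zero_mem _
  | succ r ih =>
    refine fieldFiltration_induction hw (fun u => ?_) (fun η w hw => ?_) (fun v w hv hw => ?_)
      fun w hw => ?_
    · rw [hA, hf, zero_smul, map_zero]
      exact AddSubgroup.zero_mem _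
    · rw [function_field_smul]
      exact AddSubgroup.sub_mem _ (field_smul_mem η (ih hw)) (function_smul_mem hA _ hw)
    · rw [smul_add]; exact AddSubgroup.add_mem _ hv hw
    · rw [smul_neg]; exact AddSubgroup.neg_mem _ hw

/-- Each filtration step is only an additive subgroup; division by n is multiplication by the
constant function 1/n. -/
theorem mem_of_nsmul_mem [CharZero k] {n r : ℕ} (hn : n ≠ 0) {w : R}
    (hw : n • w ∈ fieldFiltration k A ι r) : w ∈ fieldFiltration k A ι r := by
  have h := function_smul_mem hA (algebraMap k A (n : k)⁻¹) hw
  rwa [← Nat.cast_smul_eq_nsmul (AV k A), smul_smul, ← map_natCast (algebraMap k (AV k A)) n,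
    AlgHom.commutes, ← map_mul, inv_mul_cancel₀ (Nat.cast_ne_zero.2 hn), map_one, one_smul] at h

variable (hV : ∀ η ∈ vanishingFields ε 0, ∀ u, ∃ v, ofField η • ι u = ι v)

omit [Module k U] hA in
include hV in
-- Commuting η past ξ costs [η, ξ], which takes the place of ξ, so the number of fields does not
-- grow; at the end η acts on the image of ι.
theorem vanishing_field_smul_mem {η : Derivation k A A} (hη : η ∈ vanishingFields ε 0) {r : ℕ}
    {w : R} (hw : w ∈ fieldFiltration k A ι r) : ofField η • w ∈ fieldFiltration k A ι r := by
  induction r generalizing w with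
  | zero => rw [mem_fieldFiltration_zero.1 hw, smul_zero]; exact AddSubgroup.zero_mem _
  | succ r ih =>
    refine fieldFiltration_induction hw (fun u => ?_) (fun ξ w hw => ?_) (fun v w hv hw => ?_)
      fun w hw => ?_
    · obtain ⟨v, hv⟩ := hV η hη u
      rw [hv]
      exact apply_mem_fieldFiltration r _
    · rw [field_field_smul]
      exact AddSubgroup.add_mem _ (field_smul_mem ξ (ih hw)) (field_smul_mem _ hw)
    · rw [smul_add]; exact AddSubgroup.add_mem _ hv hw
    · rw [smul_neg]; exact AddSubgroup.neg_mem _ hw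

include hV in
/-- The Euler operator acts on the `r`-th layer of the filtration as multiplication by `-r`. -/
theorem euler_smul_add_nsmul_mem {B : Type*} [CommRing B] [Algebra k B] [Algebra A B]
    [IsScalarTower k A B] {s : ℕ} (c : LocalCoordinates ε B s) {r : ℕ} {w : R}
    (hw : w ∈ fieldFiltration k A ι (r + 1)) :
    ∑ i, ofField (c.field i) • ofFunction k A (c.x i) • w + r • w ∈ fieldFiltration k A ι r := by
  induction r generalizing w with
  | zero =>
    rw [zero_smul, add_zero]
    refine AddSubgroup.sum_mem _ fun i _ => ?_
    have h := vanishing_function_smul_mem hA (c.ε_x i) hw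
    rw [mem_fieldFiltration_zero.1 h, smul_zero]
    exact AddSubgroup.zero_mem _
  | succ r ih =>
    refine fieldFiltration_induction hw (fun u => ?_) (fun η w hw => ?_) (fun v w hv hw => ?_)
      fun w hw => ?_
    · refine AddSubgroup.add_mem _ (AddSubgroup.sum_mem _ fun i _ => ?_)
        (AddSubgroup.nsmul_mem _ (apply_mem_fieldFiltration r u) _)
      rw [hA, c.ε_x, zero_smul, map_zero, smul_zero]
      exact AddSubgroup.zero_mem _
    -- Commute x_i and then ∂_i past η, and split η(x_i) into its value at p and a part in 𝔪_p.
    -- Summed over i, the value terms give -ηw modulo the lower step, by `h4`: this is the extra -1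
    -- in the eigenvalue. The terms in `h6` and `h7` are lower because a function in 𝔪_p hits w
    -- first.
    · have h1 : ∀ i, ofField (c.field i) • ofFunction k A (c.x i) • ofField η • w =
          ofField η • ofField (c.field i) • ofFunction k A (c.x i) • w +
            ofField ⁅c.field i, η⁆ • ofFunction k A (c.x i) • w -
            ofField (c.field i) • ofFunction k A (η (c.x i) - algebraMap k A (ε (η (c.x i)))) • w -
            ofField (ε (η (c.x i)) • c.field i) • w := fun i => by
        have h2 : ofField (ε (η (c.x i)) • c.field i) • w =
            ofField (c.field i) • ofFunction k A (algebraMap k A (ε (η (c.x i)))) • w := by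
          rw [smul_smul, map_smul, AlgHom.commutes, Algebra.smul_def, Algebra.commutes]
        rw [h2, function_field_smul, smul_sub, field_field_smul, map_sub, sub_smul, smul_sub]
        abel
      have h3 : η - ∑ i, ε (η (c.x i)) • c.field i ∈ vanishingFields ε 0 :=
        c.sub_sum_field_mem_vanishingFields η
      have h4 := vanishing_field_smul_mem hV h3 hw
      rw [map_sub, sub_smul, map_sum, Finset.sum_smul] at h4
      have h5 := field_smul_mem η (ih hw)
      rw [smul_add, Finset.smul_sum, smul_comm (ofField η) r w] at h5
      have h6 := AddSubgroup.sum_mem (fieldFiltration k A ι (r + 1)) (t := Finset.univ)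
        fun i _ => field_smul_mem ⁅c.field i, η⁆ (vanishing_function_smul_mem hA (c.ε_x i) hw)
      have h7 := AddSubgroup.sum_mem (fieldFiltration k A ι (r + 1)) (t := Finset.univ)
        fun i _ => field_smul_mem (c.field i) (vanishing_function_smul_mem hA
          (f := η (c.x i) - algebraMap k A (ε (η (c.x i)))) (by simp) hw)
      convert AddSubgroup.add_mem _ (AddSubgroup.sub_mem _ (AddSubgroup.add_mem _ h5 h6) h7) h4
        using 1
      simp only [h1, Finset.sum_add_distrib, Finset.sum_sub_distrib, add_smul, one_smul]
      abel
    · simp only [smul_add, Finset.sum_add_distrib]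
      rw [add_add_add_comm]
      exact AddSubgroup.add_mem _ hv hw
    · simp only [smul_neg, Finset.sum_neg_distrib]
      rw [← neg_add]
      exact AddSubgroup.neg_mem _ hw

theorem exists_smul_mem_fieldFiltration (b : AV k A) (r : ℕ) {w : R}
    (hw : w ∈ fieldFiltration k A ι r) : ∃ n, b • w ∈ fieldFiltration k A ι n := by
  induction b using SmashProduct.generator_induction generalizing r w with
  | hA f => exact ⟨r, function_smul_mem hA f hw⟩
  | hL η => exact ⟨r + 1, field_smul_mem η hw⟩
  | hm a b ha hb =>
    obtain ⟨n, hn⟩ := hb r hw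
    rw [mul_smul]
    exact ha n hn
  | ha a b ha hb =>
    obtain ⟨m, hm⟩ := ha r hw
    obtain ⟨n, hn⟩ := hb r hw
    rw [add_smul]
    exact ⟨max m n, AddSubgroup.add_mem _ (fieldFiltration_mono (le_max_left m n) hm)
      (fieldFiltration_mono (le_max_right m n) hn)⟩

theorem exists_mem_fieldFiltration (hspan : Submodule.span (AV k A) (Set.range ι) = ⊤) (w : R) :
    ∃ r, w ∈ fieldFiltration k A ι r := by
  have hw : w ∈ Submodule.span (AV k A) (Set.range ι) := hspan ▸ trivial
  induction hw using Submodule.span_induction with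
  | mem w h =>
    obtain ⟨u, rfl⟩ := h
    exact ⟨1, apply_mem_fieldFiltration 0 u⟩
  | zero => exact ⟨0, AddSubgroup.zero_mem _⟩
  | add v w _ _ hv hw =>
    obtain ⟨m, hm⟩ := hv
    obtain ⟨n, hn⟩ := hw
    exact ⟨max m n, AddSubgroup.add_mem _ (fieldFiltration_mono (le_max_left m n) hm)
      (fieldFiltration_mono (le_max_right m n) hn)⟩
  | smul b w _ hw =>
    obtain ⟨r, hr⟩ := hw
    exact exists_smul_mem_fieldFiltration hA b r hr

include hV in
/-- A non-zero submodule meets the image of `ι`. -/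
theorem exists_apply_mem_submodule [CharZero k] {B : Type*} [CommRing B] [Algebra k B]
    [Algebra A B] [IsScalarTower k A B] {s : ℕ} (c : LocalCoordinates ε B s)
    (N : Submodule (AV k A) R) (r : ℕ) {w : R} (hw : w ∈ fieldFiltration k A ι r) (hwN : w ∈ N)
    (hw0 : w ≠ 0) : ∃ u, ι u ∈ N ∧ ι u ≠ 0 := by
  induction r generalizing w with
  | zero => exact absurd (mem_fieldFiltration_zero.1 hw) hw0
  | succ r ih =>
    by_cases h : ∃ f, ε f = 0 ∧ ofFunction k A f • w ≠ 0
    · obtain ⟨f, hf, hfw⟩ := h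
      exact ih (vanishing_function_smul_mem hA hf hw) (N.smul_mem _ hwN) hfw
    · push Not at h
      rcases Nat.eq_zero_or_pos r with rfl | hr
      · obtain ⟨u, rfl⟩ := mem_range_of_mem_fieldFiltration_one hw
        exact ⟨u, hwN, hw0⟩
      -- Here all of 𝔪_p kills w, so the Euler operator does too; only r w remains, and r ≠ 0 can be
      -- divided out.
      · have he := euler_smul_add_nsmul_mem hA hV c hw
        simp only [h _ (c.ε_x _), smul_zero, Finset.sum_const_zero, zero_add] at he
        exact ih (mem_of_nsmul_mem hA hr.ne' he) hwN hw0

omit hA in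
/-- An `A𝒱`-module generated by a simple `𝒱₊ / 𝒱(1)`-module, on which functions act by evaluation at
the point, is simple. -/
theorem isSimpleModule_of_generated [CharZero k] [LieRingModule (LinearFields ε) U]
    [LieModule k (LinearFields ε) U] [LieModule.IsIrreducible k (LinearFields ε) U] [Nontrivial R]
    {B : Type*} [CommRing B] [Algebra k B] [Algebra A B] [IsScalarTower k A B] {s : ℕ}
    (c : LocalCoordinates ε B s) (hA : ∀ f u, ofFunction k A f • ι u = ι (ε f • u))
    (hV : ∀ (η : vanishingFields ε 0) u,
      ofField (η : Derivation k A A) • ι u = ι ⁅linearFieldsMk ε η, u⁆)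
    (hspan : Submodule.span (AV k A) (Set.range ι) = ⊤) : IsSimpleModule (AV k A) R := by
  rw [isSimpleModule_iff]
  refine IsSimpleOrder.of_forall_eq_top fun N hN => ?_
  obtain ⟨w, hwN, hw0⟩ := N.ne_bot_iff.1 hN
  obtain ⟨r, hr⟩ := exists_mem_fieldFiltration hA hspan w
  obtain ⟨u, huN, hu0⟩ := exists_apply_mem_submodule hA (fun η hη u => ⟨_, hV ⟨η, hη⟩ u⟩) c N r hr
    hwN hw0
  -- The preimage of N in U is stable under 𝒱₊/𝒱(1), so irreducibility leaves only 0 or U. Stability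
  -- under scalars comes from the constant functions.
  let N' : LieSubmodule k (LinearFields ε) U :=
    { carrier := {u | ι u ∈ N}
      zero_mem' := by simp
      add_mem' := fun ha hb => by
        rw [Set.mem_ofPred_eq, map_add]
        exact N.add_mem ha hb
      smul_mem' := fun a u hu => by
        have h := hA (algebraMap k A a) u
        rw [ε.commutes, Algebra.algebraMap_self, RingHom.id_apply] at h
        rw [Set.mem_ofPred_eq, ← h]
        exact N.smul_mem _ hu
      lie_mem := fun {x u} hu => by
        obtain ⟨η, rfl⟩ := Submodule.Quotient.mk_surjective _ x
        have h := N.smul_mem (ofField (η : Derivation k A A)) hu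
        rwa [hV] at h }
  have hne : N' ≠ ⊥ := fun h => hu0 (by
    have hu : u ∈ N' := huN
    rw [h, LieSubmodule.mem_bot] at hu
    rw [hu, map_zero])
  have htop : N' = ⊤ := (eq_bot_or_eq_top N').resolve_left hne
  rw [eq_top_iff, ← hspan, Submodule.span_le]
  rintro _ ⟨v, rfl⟩
  have hv : v ∈ N' := htop ▸ trivial
  exact hv

end Simplicity

/-! ### Homomorphisms out of the smash product, evaluated on generators -/

namespace SmashProduct

variable {k A L S : Type*} [CommRing k] [CommRing A] [Algebra k A] [LieRing L] [LieAlgebra k L]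
  [Ring S] [Algebra k S] {ρ : L →ₗ⁅k⁆ Derivation k A A} (α : A →ₐ[k] S) (φ : L →ₗ⁅k⁆ S)
  (h : ∀ x f, φ x * α f = α (ρ x f) + α f * φ x)

theorem lift_ofAlgebra (f : A) : lift α φ h (ofAlgebra ρ f) = α f := by
  rw [ofAlgebra_apply, lift_tmul, map_one, mul_one]

theorem lift_ofLie (x : L) : lift α φ h (ofLie ρ x) = φ x := by
  rw [ofLie_apply, lift_tmul, map_one, one_mul, UniversalEnvelopingAlgebra.lift_ι_apply]

end SmashProduct

/-! ### Induced modules -/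

section InducedModule

variable {k C S U : Type*} [CommRing k] [Ring C] [Algebra k C] [Ring S] [Algebra k S]
  [AddCommGroup U] [Module k U] (φ : C →ₐ[k] S) (τ : C →ₐ[k] Module.End k U)

/-- The map `u ↦ 1 ⊗ u` to the induced module. -/
def toInducedModule : U →+ InducedModule φ τ :=
  (inducedRelations φ τ).mkQ.toAddMonoidHom.comp (TensorProduct.mk k S U 1).toAddMonoidHom

theorem smul_toInducedModule (b : S) (u : U) :
    b • toInducedModule φ τ u = (inducedRelations φ τ).mkQ (b ⊗ₜ[k] u) := by
  change (inducedRelations φ τ).mkQ (b • ((1 : S) ⊗ₜ[k] u)) = _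
  rw [TensorProduct.smul_tmul', smul_eq_mul, mul_one]

theorem map_smul_toInducedModule (a : C) (u : U) :
    φ a • toInducedModule φ τ u = toInducedModule φ τ (τ a u) := by
  rw [smul_toInducedModule]
  refine (Submodule.Quotient.eq _).2 (Submodule.subset_span ⟨1, a, u, ?_⟩)
  rw [one_mul]
  rfl

theorem span_range_toInducedModule :
    Submodule.span S (Set.range (toInducedModule φ τ)) = ⊤ := by
  refine eq_top_iff.2 fun w _ => ?_
  obtain ⟨z, rfl⟩ := Submodule.mkQ_surjective _ w
  clear * -
  induction z using TensorProduct.induction_on with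
  | zero => exact Submodule.zero_mem _
  | tmul b u =>
    rw [← smul_toInducedModule]
    exact Submodule.smul_mem _ b (Submodule.subset_span ⟨u, rfl⟩)
  | add a b ha hb => exact Submodule.add_mem _ ha hb

/-- The induced module is non-zero if there is a non-zero homomorphism to an `S`-module. -/
theorem nontrivial_inducedModule {W : Type*} [AddCommGroup W] [Module k W]
    (Θ : S →ₐ[k] Module.End k W) (δ : U →ₗ[k] W) (h : ∀ a u, Θ (φ a) (δ u) = δ (τ a u))
    {u : U} (hu : δ u ≠ 0) : Nontrivial (InducedModule φ τ) := by
  let T : S ⊗[k] U →ₗ[k] W := TensorProduct.lift (Θ.toLinearMap.compl₂ δ)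
  have hT : ∀ b u, T (b ⊗ₜ u) = Θ b (δ u) := fun b u => rfl
  have hTsmul : ∀ (b : S) z, T (b • z) = Θ b (T z) := fun b z => by
    induction z using TensorProduct.induction_on with
    | zero => simp
    | tmul a u => rw [TensorProduct.smul_tmul', hT, hT, smul_eq_mul, map_mul, Module.End.mul_apply]
    | add x y hx hy => rw [smul_add, map_add, hx, hy, map_add, map_add]
  have hker : ∀ z ∈ inducedRelations φ τ, T z = 0 := fun z hz => by
    induction hz using Submodule.span_induction with
    | mem z hz =>
      obtain ⟨b, a, u, rfl⟩ := hz
      rw [map_sub, hT, hT, map_mul, Module.End.mul_apply, h, sub_self]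
    | zero => exact map_zero T
    | add x y _ _ hx hy => rw [map_add, hx, hy, add_zero]
    | smul b z _ hz => rw [hTsmul, hz, map_zero]
  refine Submodule.Quotient.nontrivial_iff.2 fun htop => hu ?_
  have h1 := hker ((1 : S) ⊗ₜ u) (htop ▸ trivial)
  rwa [hT, map_one, Module.End.one_apply] at h1

end InducedModule

/-! ### Rudakov modules -/

section Rudakov

variable {k A : Type*} [Field k] [CommRing A] [Algebra k A] {ε : A →ₐ[k] k}

theorem avPlusIncl_ofAlgebra (f : A) :
    avPlusIncl ε (SmashProduct.ofAlgebra _ f) = AV.ofFunction k A f := 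
  SmashProduct.lift_ofAlgebra _ _ _ f

theorem avPlusIncl_ofLie (η : vanishingFields ε 0) :
    avPlusIncl ε (SmashProduct.ofLie _ η) = AV.ofField (η : Derivation k A A) := 
  SmashProduct.lift_ofLie _ _ _ η

variable (U : Type*) [AddCommGroup U] [Module k U] [LieRingModule (LinearFields ε) U]
  [LieModule k (LinearFields ε) U]

theorem avPlusAction_ofAlgebra (f : A) (u : U) :
    avPlusAction ε U (SmashProduct.ofAlgebra _ f) u = ε f • u := 
  LinearMap.congr_fun (SmashProduct.lift_ofAlgebra _ _ _ f) u

theorem avPlusAction_ofLie (η : vanishingFields ε 0) (u : U) :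
    avPlusAction ε U (SmashProduct.ofLie _ η) u = ⁅linearFieldsMk ε η, u⁆ := 
  LinearMap.congr_fun (SmashProduct.lift_ofLie _ _ _ η) u

variable {B : Type*} [CommRing B] [Algebra k B] [Algebra A B] [IsScalarTower k A B] {s : ℕ}
  (c : LocalCoordinates ε B s)

include c in
theorem nontrivial_rudakovModule [Nontrivial U] : Nontrivial (RudakovModule ε U) := by
  obtain ⟨u, hu⟩ := exists_ne (0 : U)
  let ρ : Matrix (Fin s) (Fin s) k →ₗ⁅k⁆ Module.End k U :=
    (LieModule.toEnd k (LinearFields ε) U).comp c.linearFieldsEquiv.symm.toLieHom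
  have hρ : ∀ η : vanishingFields ε 0, ∀ u, ρ (c.linearPart η) u = ⁅linearFieldsMk ε η, u⁆ :=
    fun η u => by
      rw [← c.linearFieldsEquiv_mk]
      change ⁅c.linearFieldsEquiv.symm (c.linearFieldsEquiv (linearFieldsMk ε η)), u⁆ = _
      rw [LieEquiv.symm_apply_apply]
  -- Equivariance of `delta` is checked on functions and fields, which generate A # U(𝒱₊). A delta
  -- function recovers u by evaluation at the constant 1.
  refine nontrivial_inducedModule _ _ (c.smashOp ρ) c.delta (fun a u => ?_) (u := u) fun h => hu ?_
  · induction a using SmashProduct.generator_induction generalizing u with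
    | hA f =>
      rw [avPlusIncl_ofAlgebra, avPlusAction_ofAlgebra, ← c.functionOp_delta,
        LocalCoordinates.smashOp, SmashProduct.lift_ofAlgebra]
    | hL η =>
      rw [avPlusIncl_ofLie, avPlusAction_ofLie, ← hρ, ← c.fieldOp_delta ρ η.2,
        LocalCoordinates.smashOp, SmashProduct.lift_ofLie]
    | hm a b ha hb => simp only [map_mul, Module.End.mul_apply, hb, ha]
    | ha a b ha hb => simp only [map_add, LinearMap.add_apply, ha, hb]
  · have h1 := LinearMap.congr_fun h 1
    rwa [c.delta_apply, map_one, one_smul] at h1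

include c in
theorem isSimpleModule_rudakovModule [CharZero k]
    [LieModule.IsIrreducible k (LinearFields ε) U] :
    IsSimpleModule (AV k A) (RudakovModule ε U) := by
  have : Nontrivial U := LieModule.nontrivial_of_isIrreducible k (LinearFields ε) U
  have : Nontrivial (RudakovModule ε U) := nontrivial_rudakovModule U c
  refine isSimpleModule_of_generated (ι := toInducedModule (avPlusIncl ε) (avPlusAction ε U)) c
    (fun f u => ?_) (fun η u => ?_) (span_range_toInducedModule _ _)
  · rw [← avPlusIncl_ofAlgebra, map_smul_toInducedModule, avPlusAction_ofAlgebra]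
  · rw [← avPlusIncl_ofLie, map_smul_toInducedModule, avPlusAction_ofLie]

end Rudakov

/-! ### From the variety to its coordinate ring -/

/-- If f g vanishes on X, the zero loci of f and g cover X, so by irreducibility one of them
contains it. -/
theorem IsIrreducibleAffineVariety.isPrime_vanishingIdeal {k : Type*} [Field k] {n : ℕ}
    {X : Set (Fin n → k)} (hX : IsIrreducibleAffineVariety X) :
    (MvPolynomial.vanishingIdeal k X).IsPrime := by
  refine ⟨fun h => ?_, fun {f g} hfg => ?_⟩
  · obtain ⟨x, hx⟩ := hX.nonempty
    have h1 := (MvPolynomial.mem_vanishingIdeal_iff (k := k)).1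
      (h ▸ trivial : (1 : MvPolynomial (Fin n) k) ∈ MvPolynomial.vanishingIdeal k X) x hx
    rw [map_one] at h1
    exact one_ne_zero h1
  · have hmem : ∀ (f : MvPolynomial (Fin n) k) (x : Fin n → k),
        x ∈ MvPolynomial.zeroLocus k (Ideal.span {f}) ↔ MvPolynomial.aeval x f = 0 := by
      intro f x
      rw [MvPolynomial.zeroLocus_span]
      simp
    refine (hX.irreducible (MvPolynomial.zeroLocus k (Ideal.span {f}))
      (MvPolynomial.zeroLocus k (Ideal.span {g})) ⟨_, rfl⟩ ⟨_, rfl⟩ fun x hx => ?_).imp ?_ ?_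
    · have h := MvPolynomial.mem_vanishingIdeal_iff.1 hfg x hx
      rw [map_mul] at h
      exact (mul_eq_zero.1 h).imp (hmem f x).2 (hmem g x).2
    · exact fun h x hx => (hmem f x).1 (h hx)
    · exact fun h x hx => (hmem g x).1 (h hx)

end

theorem mainTheorem1 {k : Type*} [Field k] [IsAlgClosed k] [CharZero k]
    {n s : ℕ} (X : Set (Fin n → k)) (hX : IsIrreducibleAffineVariety X)
    (hs : ringKrullDim (CoordinateRing X) = s)
    (p : X) (hp : IsNonsingularPoint (evalPoint X p)) :
    Nonempty (LinearFields (evalPoint X p) ≃ₗ⁅k⁆ Matrix (Fin s) (Fin s) k) ∧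
    ∀ (U : Type*) [AddCommGroup U] [Module k U]
      [LieRingModule (LinearFields (evalPoint X p)) U]
      [LieModule k (LinearFields (evalPoint X p)) U],
      Module.Finite k U → LieModule.IsIrreducible k (LinearFields (evalPoint X p)) U →
      IsSimpleModule (AV k (CoordinateRing X)) (RudakovModule (evalPoint X p) U) := by
  have := hX.isPrime_vanishingIdeal
  have : IsDomain (CoordinateRing X) := Ideal.Quotient.isDomain _
  obtain ⟨c⟩ := nonempty_localCoordinates (evalPoint X p) hs hp
  exact ⟨⟨c.linearFieldsEquiv⟩, fun U _ _ _ _ _ _ => isSimpleModule_rudakovModule U c⟩
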